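/- Theorem 2. Let $\mathbb{T}$ be $\mathbb{R}$ or $\mathbb{Z}$, let $m\in\mathbb{N}$, and let $\mathbf{B}_n:\mathbb{T}\to\mathbb{R}^{m\times m}$ ($n=0,1,2,\dots$) be matrix functions, not necessarily symmetric. Let $\mathbb{S}^d$ be the unit sphere of $\mathbb{R}^{d+1}$ with the spherical distance $\vartheta(\mathbf{x}_1,\mathbf{x}_2)=\arccos(\mathbf{x}_1'\mathbf{x}_2)$. An $m\times m$ matrix function $\mathbf{C}(\vartheta;t)$, $\vartheta\in[0,\pi]$, $t\in\mathbb{T}$, is the covariance matrix function of an $m$-variate random field $\{\mathbf{Z}(\mathbf{x};t)\}$ on $\mathbb{S}^d\times\mathbb{T}$ if $\mathbf{Z}$ has finite second-order moments and constant mean, and $\operatorname{cov}(\mathbf{Z}(\mathbf{x}_1;t_1),\mathbf{Z}(\mathbf{x}_2;t_2))=\mathbf{C}(\vartheta(\mathbf{x}_1,\mathbf{x}_2);t_1-t_2)$ for all $\mathbf{x}_1,\mathbf{x}_2\in\mathbb{S}^d$, $t_1,t_2\in\mathbb{T}$. A matrix function $\mathbf{B}$ on $\mathbb{T}$ is a stationary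 covariance matrix function if there is an $m$-variate second-order process $\{\mathbf{V}(t),t\in\mathbb{T}\}$ with constant mean and $\operatorname{cov}(\mathbf{V}(t_1),\mathbf{V}(t_2))=\mathbf{B}(t_1-t_2)$ for all $t_1,t_2\in\mathbb{T}$. A random field is elliptically contoured if each of its finite-dimensional distributions has a characteristic function of the form $\mathbf{u}\mapsto e^{i\mathbf{u}'\mathbf{c}}\varphi(\mathbf{u}'\mathbf{\Sigma}\mathbf{u})$ with a vector $\mathbf{c}$, a positive semidefinite matrix $\mathbf{\Sigma}$ and a real function $\varphi$. For $\lambda>0$ let $P_n^{(\lambda)}$ be the ultraspherical polynomials: $P_0^{(\lambda)}=1$, $P_1^{(\lambda)}(x)=2\lambda x$, and $nP_n^{(\lambda)}(x)=2(\lambda+n-1)xP_{n-1}^{(\lambda)}(x)-(2\lambda+n-2)P_{n-2}^{(\lambda)}(x)$ for $n\ge2$. Convergence of a series means convergence of its partial sums. (i) The series $$\mathbf{C}(\vartheta;t)=\sum_{n=0}^\infty\mathbf{B}_n(t)\cos(n\vartheta),\qquad\vartheta\in[0,\pi],\ t\in\mathbb{T},$$ converges for all $\vartheta$ and $t$ and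 its sum is the covariance matrix function of an $m$-variate Gaussian random field on $\mathbb{S}^1\times\mathbb{T}$ if and only if $\sum_{n=0}^\infty\mathbf{B}_n(0)$ converges and $\mathbf{B}_n$ is a stationary covariance matrix function on $\mathbb{T}$ for each $n\ge0$. The same equivalence holds with "elliptically contoured" in place of "Gaussian". (ii) Let $d\ge2$. The series $$\mathbf{C}(\vartheta;t)=\sum_{n=0}^\infty\mathbf{B}_n(t)P_n^{\left(\frac{d-1}{2}\right)}(\cos\vartheta),\qquad\vartheta\in[0,\pi],\ t\in\mathbb{T},$$ converges for all $\vartheta$ and $t$ and its sum is the covariance matrix function of an $m$-variate Gaussian random field on $\mathbb{S}^d\times\mathbb{T}$ if and only if $\sum_{n=0}^\infty\mathbf{B}_n(0)P_n^{\left(\frac{d-1}{2}\right)}(1)$ converges and $\mathbf{B}_n$ is a stationary covariance matrix function on $\mathbb{T}$ for each $n\ge0$. The same equivalence holds with "elliptically contoured" in place of "Gaussian". -/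

import Mathlib

open MeasureTheory ProbabilityTheory Filter Topology

noncomputable section

/-- The ultraspherical (Gegenbauer) polynomial functions `P_n^{(lam)}`, by the three-term
recurrence. -/
def ultraspherical (lam : ℝ) : ℕ → ℝ → ℝ
  | 0, _ => 1
  | 1, x => 2 * lam * x
  | n + 2, x =>
      (2 * (lam + n + 1) * x * ultraspherical lam (n + 1) x
        - (2 * lam + n) * ultraspherical lam n x) / (n + 2)

/-- The unit sphere `S^d` in `ℝ^(d+1)`. -/
abbrev UnitSphere (d : ℕ) : Type :=
  Metric.sphere (0 : EuclideanSpace ℝ (Fin (d + 1))) 1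

/-- The spherical (geodesic) distance `arccos (x'y)` on `S^d`. -/
def sphericalDist {d : ℕ} (x y : UnitSphere d) : ℝ :=
  Real.arccos (inner ℝ (x : EuclideanSpace ℝ (Fin (d + 1))) (y : EuclideanSpace ℝ (Fin (d + 1))))

/-- Ordinary convergence of a series of matrices: the partial sums tend to `S`. -/
def SeriesTendsTo {m : ℕ} (A : ℕ → Matrix (Fin m) (Fin m) ℝ) (S : Matrix (Fin m) (Fin m) ℝ) :
    Prop :=
  Tendsto (fun N : ℕ => ∑ n ∈ Finset.range N, A n) atTop (𝓝 S)

/-- The (cross-)covariance matrix `E[(X - E X) (Y - E Y)']` of two random vectors. -/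
def covMatrix {Ω : Type} [MeasurableSpace Ω] {m : ℕ} (X Y : Ω → Fin m → ℝ) (P : Measure Ω) :
    Matrix (Fin m) (Fin m) ℝ :=
  Matrix.of fun i j => covariance (fun ω => X ω i) (fun ω => Y ω j) P

/-- An `m`-variate random field with finite second-order moments and constant mean. -/
structure IsSecondOrderConstMean {Ω : Type} [MeasurableSpace Ω] {ι : Type} {m : ℕ}
    (Z : ι → Ω → Fin m → ℝ) (P : Measure Ω) : Prop where
  memLp : ∀ p i, MemLp (fun ω => Z p ω i) 2 P
  mean : ∃ c : Fin m → ℝ, ∀ p i, ∫ ω, Z p ω i ∂P = c i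

/-- `B` is a stationary covariance matrix function on `T`: there is an `m`-variate second-order
(wide-sense) stationary process `V` on `T` with `cov (V t₁, V t₂) = B (t₁ - t₂)`. -/
def IsStationaryCovFun {T : Type} [AddCommGroup T] {m : ℕ}
    (B : T → Matrix (Fin m) (Fin m) ℝ) : Prop :=
  ∃ (Ω : Type) (_ : MeasurableSpace Ω) (P : Measure Ω) (_ : IsProbabilityMeasure P)
    (V : T → Ω → Fin m → ℝ),
    IsSecondOrderConstMean V P ∧ ∀ t₁ t₂, covMatrix (V t₁) (V t₂) P = B (t₁ - t₂)

/-- The random field `Z` on `S^d × T` is (wide-sense) isotropic on `S^d` and stationary on `T`,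
with covariance matrix function `C (ϑ; t)`. -/
structure HasIsotropicStationaryCov {Ω : Type} [MeasurableSpace Ω] {T : Type} [AddCommGroup T]
    {m d : ℕ} (Z : UnitSphere d × T → Ω → Fin m → ℝ) (P : Measure Ω)
    (C : ℝ → T → Matrix (Fin m) (Fin m) ℝ) : Prop where
  secondOrder : IsSecondOrderConstMean Z P
  cov_eq : ∀ x₁ x₂ t₁ t₂,
    covMatrix (Z (x₁, t₁)) (Z (x₂, t₂)) P = C (sphericalDist x₁ x₂) (t₁ - t₂)

/-- The random vector `X` has an elliptically contoured distribution: its characteristic function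
is `exp (i u'c) φ (u'Σu)` for some location `c`, positive semidefinite matrix `Σ` and
characteristic generator `φ`. -/
def IsEllipticallyContoured {Ω : Type} [MeasurableSpace Ω] {κ : Type} [Fintype κ]
    (X : Ω → EuclideanSpace ℝ κ) (P : Measure Ω) : Prop :=
  AEMeasurable X P ∧
    ∃ (c : EuclideanSpace ℝ κ) (S : Matrix κ κ ℝ) (φ : ℝ → ℝ), S.PosSemidef ∧
      ∀ u : EuclideanSpace ℝ κ,
        charFun (P.map X) u =
          Complex.exp (((inner ℝ u c : ℝ) : ℂ) * Complex.I)
            * ((φ (u.ofLp ⬝ᵥ S.mulVec u.ofLp) : ℝ) : ℂ)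

/-- The random field `Z` is elliptically contoured: all its finite-dimensional distributions are
elliptically contoured. -/
def IsEllipticallyContouredField {Ω : Type} [MeasurableSpace Ω] {ι : Type} {m : ℕ}
    (Z : ι → Ω → Fin m → ℝ) (P : Measure Ω) : Prop :=
  ∀ I : Finset ι,
    IsEllipticallyContoured
      (fun ω => (WithLp.toLp 2 (fun q : I × Fin m => Z q.1 ω q.2) :
        EuclideanSpace ℝ (I × Fin m))) P

/-- `C` is the covariance matrix function of an `m`-variate Gaussian random field on
`S^d × T`. -/
def IsCovFunOfGaussianField {T : Type} [AddCommGroup T] {m : ℕ} (d : ℕ)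
    (C : ℝ → T → Matrix (Fin m) (Fin m) ℝ) : Prop :=
  ∃ (Ω : Type) (_ : MeasurableSpace Ω) (P : Measure Ω) (_ : IsProbabilityMeasure P)
    (Z : UnitSphere d × T → Ω → Fin m → ℝ),
    IsGaussianProcess Z P ∧ HasIsotropicStationaryCov Z P C

/-- `C` is the covariance matrix function of an `m`-variate (second-order) elliptically contoured
random field on `S^d × T`. -/
def IsCovFunOfEllipticalField {T : Type} [AddCommGroup T] {m : ℕ} (d : ℕ)
    (C : ℝ → T → Matrix (Fin m) (Fin m) ℝ) : Prop :=
  ∃ (Ω : Type) (_ : MeasurableSpace Ω) (P : Measure Ω) (_ : IsProbabilityMeasure P)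
    (Z : UnitSphere d × T → Ω → Fin m → ℝ),
    IsEllipticallyContouredField Z P ∧ HasIsotropicStationaryCov Z P C

/-- The matrix series `∑ B_n(t) g_n(ϑ)` converges for all `ϑ ∈ [0, π]` and `t ∈ T`, with
sum `C (ϑ; t)`. -/
def IsSeriesExpansion {T : Type} {m : ℕ} (g : ℕ → ℝ → ℝ)
    (B : ℕ → T → Matrix (Fin m) (Fin m) ℝ) (C : ℝ → T → Matrix (Fin m) (Fin m) ℝ) : Prop :=
  ∀ ϑ ∈ Set.Icc (0 : ℝ) Real.pi, ∀ t : T, SeriesTendsTo (fun n => g n ϑ • B n t) (C ϑ t)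

end

/-! Both sides of each equivalence are statements about positive definite kernels. Covariances
always form such a kernel. Conversely, a positive definite kernel is a Gram matrix in a Hilbert
space, and an isonormal Gaussian family over that space turns it into the covariance of a centred
Gaussian process (`IsPosDefKernel.exists_gaussianProcess`). Gaussian fields are elliptically
contoured, so the Gaussian and elliptical classes both reduce to positive definiteness of
`isotropicKernel`. The functions `cos (nϑ)` and the ultraspherical polynomials are positive
multiples `q n` of the zonal polynomials `p_n (cos ϑ)` with `p_n (1) = 1`, so everything follows
from `exists_expansion_iff`. Nothing about the index set `T` is used beyond its being an abelian
group.

Sufficiency: the diagonal entries of `B_n(0)` are nonnegative, so their convergent series converge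
absolutely. They dominate all entries of `B_n(t)`, and `|p_n| ≤ 1` on `[-1, 1]`, so the full series
converges. Its sum is a limit of sums of Schur products of positive definite kernels, the zonal
factor being handled by the reproducing formula `integral_zonalPoly_mul_zonalPoly`.

Necessity: contracting time and component indices with weights leaves a scalar positive definite
kernel `f (x'y)` on the sphere with `f = ∑ b_n p_n`, and `b_n ≥ 0` is wanted
(`coeff_nonneg_of_isPosDefKernel`). The difficulty is that convergence is only pointwise and `f`
need not be continuous, so integrating termwise is not allowed. Positive definiteness does give `|f|
≤ f 1`. The series is regularised by the resolvent `(1 - sΔ)⁻¹` of the Laplacian, whose factors are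
summable; a maximum principle (`resolventSum_le`) shows that the regularised sums obey the same
bounds as `f`. As `s → 0` they converge to `f` by Abel summation, and dominated convergence
identifies `b_n` as a Fourier coefficient of `f`. The kernel `f p_n` is again positive definite, and
the integral of each of its sections is a positive multiple of `b_n`, which forces `b_n ≥ 0`
(`IsPosDefKernel.integral_nonneg`). -/

/-! ### Isonormal Gaussian families -/

/-- A centred square-integrable variable with characteristic function that of `N(0, ‖Y‖²)`. -/
def IsCenteredGaussianLp {Ω : Type} [MeasurableSpace Ω] {P : Measure Ω} (Y : Lp ℝ 2 P) : Prop :=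
  ∀ t : ℝ, charFun (P.map Y) t = Complex.exp (-(‖Y‖ ^ 2 * t ^ 2 / 2 : ℝ))

/-- This follows from `|exp (ia) - exp (ib)| ≤ |a - b|` and from the `L¹` norm being at most the
`L²` norm under a probability measure. -/
lemma norm_integral_cexp_sub_le {Ω : Type} [MeasurableSpace Ω] {P : Measure Ω}
    [IsProbabilityMeasure P] (Y Z : Lp ℝ 2 P) (t : ℝ) :
    ‖charFun (P.map Y) t - charFun (P.map Z) t‖ ≤ |t| * ‖Y - Z‖ := by
  have mY : AEMeasurable Y P := (Lp.aestronglyMeasurable Y).aemeasurable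
  have mZ : AEMeasurable Z P := (Lp.aestronglyMeasurable Z).aemeasurable
  have hint : ∀ W : Lp ℝ 2 P, Integrable (fun ω => Complex.exp (t * W ω * Complex.I)) P := by
    intro W
    have mW : AEStronglyMeasurable W P := Lp.aestronglyMeasurable W
    refine Integrable.of_bound (C := 1) ?_ ?_
    · have : Continuous fun x : ℝ => Complex.exp (t * x * Complex.I) := by fun_prop
      exact this.comp_aestronglyMeasurable mW
    · refine ae_of_all _ fun ω => ?_
      have := Complex.norm_exp_ofReal_mul_I (t * W ω)
      push_cast at this
      exact this.le
  rw [charFun_apply_real, charFun_apply_real, integral_map mY (by fun_prop),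
    integral_map mZ (by fun_prop), ← integral_sub (hint Y) (hint Z)]
  have hYZ : MemLp (⇑(Y - Z)) 2 P := Lp.memLp _
  have h1 : Integrable (fun ω => |t| * ‖(Y - Z) ω‖) P :=
    (hYZ.integrable (by norm_num)).norm.const_mul _
  have hae : ∀ᵐ ω ∂P, ‖Complex.exp (t * Y ω * Complex.I) - Complex.exp (t * Z ω * Complex.I)‖
      ≤ |t| * ‖(Y - Z) ω‖ := by
    filter_upwards [Lp.coeFn_sub Y Z] with ω hω
    rw [hω, Pi.sub_apply]
    have e1 : Complex.exp (t * Y ω * Complex.I) - Complex.exp (t * Z ω * Complex.I)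
        = Complex.exp (Complex.I * (t * Z ω : ℝ)) *
          (Complex.exp (Complex.I * (t * (Y ω - Z ω) : ℝ)) - 1) := by
      rw [mul_sub, ← Complex.exp_add]
      push_cast
      ring_nf
    rw [e1, norm_mul]
    have e2 : ‖Complex.exp (Complex.I * (t * Z ω : ℝ))‖ = 1 := by
      rw [mul_comm]; exact Complex.norm_exp_ofReal_mul_I _
    rw [e2, one_mul]
    refine (Real.norm_exp_I_mul_ofReal_sub_one_le (x := t * (Y ω - Z ω))).trans ?_
    rw [norm_mul, Real.norm_eq_abs t]
  calc _ ≤ ∫ ω, |t| * ‖(Y - Z) ω‖ ∂P := norm_integral_le_of_norm_le h1 hae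
    _ = |t| * ∫ ω, ‖(Y - Z) ω‖ ∂P := integral_const_mul _ _
    _ ≤ |t| * ‖Y - Z‖ := by
      gcongr
      have h2 : eLpNorm (⇑(Y - Z)) 1 P ≤ eLpNorm (⇑(Y - Z)) 2 P :=
        eLpNorm_le_eLpNorm_of_exponent_le (by norm_num) (Lp.aestronglyMeasurable _)
      have h3 : ∫ ω, ‖(Y - Z) ω‖ ∂P = (eLpNorm (⇑(Y - Z)) 1 P).toReal := by
        rw [integral_norm_eq_lintegral_enorm (Lp.aestronglyMeasurable _), eLpNorm_one_eq_lintegral_enorm]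
      rw [h3, Lp.norm_def]
      exact ENNReal.toReal_mono (Lp.eLpNorm_ne_top _) h2

/-- For fixed `t` both sides of the defining identity are continuous in the `L²` norm, so centred
Gaussianity survives `L²` limits. -/
lemma isClosed_isCenteredGaussianLp {Ω : Type} [MeasurableSpace Ω] {P : Measure Ω}
    [IsProbabilityMeasure P] : IsClosed {Y : Lp ℝ 2 P | IsCenteredGaussianLp Y} := by
  simp only [IsCenteredGaussianLp, Set.ofPred_forall]
  refine isClosed_iInter fun t => isClosed_eq ?_ (by fun_prop)
  have : LipschitzWith (Real.toNNReal |t|) fun Y : Lp ℝ 2 P => charFun (P.map Y) t := by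
    refine LipschitzWith.of_dist_le_mul fun Y Z => ?_
    rw [dist_eq_norm, dist_eq_norm, Real.coe_toNNReal _ (abs_nonneg t)]
    exact norm_integral_cexp_sub_le Y Z t
  exact this.continuous

lemma IsCenteredGaussianLp.map_eq {Ω : Type} [MeasurableSpace Ω] {P : Measure Ω}
    [IsProbabilityMeasure P] {Y : Lp ℝ 2 P} (hY : IsCenteredGaussianLp Y) :
    P.map Y = gaussianReal 0 (Real.toNNReal (‖Y‖ ^ 2)) := by
  have mY : AEMeasurable Y P := (Lp.aestronglyMeasurable Y).aemeasurable
  have := Measure.isProbabilityMeasure_map (μ := P) mY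
  refine Measure.ext_of_charFun ?_
  ext t
  rw [hY t, charFun_gaussianReal, Real.coe_toNNReal _ (by positivity)]
  congr 1
  push_cast
  ring

lemma isCenteredGaussianLp_of_hasGaussianLaw {Ω : Type} [MeasurableSpace Ω] {P : Measure Ω}
    [IsProbabilityMeasure P] {Y : Lp ℝ 2 P} (hY : HasGaussianLaw Y P) (h0 : ∫ ω, Y ω ∂P = 0) :
    IsCenteredGaussianLp Y := by
  intro t
  rw [hY.map_eq_gaussianReal, charFun_gaussianReal, h0,
    Real.coe_toNNReal _ (variance_nonneg _ _), variance_of_integral_eq_zero hY.aemeasurable h0]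
  have : ‖Y‖ ^ 2 = ∫ ω, Y ω ^ 2 ∂P := by
    rw [← real_inner_self_eq_norm_sq, L2.inner_def]
    refine integral_congr_ae (ae_of_all _ fun ω => ?_)
    simp [sq]
  rw [this]
  congr 1
  push_cast
  ring

/-- The isonormal Gaussian family over a real Hilbert space. -/
lemma exists_isonormal (H : Type) [NormedAddCommGroup H] [InnerProductSpace ℝ H]
    [CompleteSpace H] :
    ∃ (Ω : Type) (_ : MeasurableSpace Ω) (P : Measure Ω) (_ : IsProbabilityMeasure P)
      (Φ : H →ₗᵢ[ℝ] Lp ℝ 2 P), ∀ h, IsCenteredGaussianLp (Φ h) := by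
  classical
  obtain ⟨w, b, -⟩ := exists_hilbertBasis ℝ H
  obtain ⟨Ω, mΩ, P, ξ, mξ, hlaw, hind, hP⟩ := exists_iid w (gaussianReal 0 1)
  have hL2 : ∀ i, MemLp (ξ i) 2 P := fun i => (hlaw i).hasGaussianLaw.memLp_two
  have hmean : ∀ i, ∫ ω, ξ i ω ∂P = 0 := by
    intro i
    rw [(hlaw i).integral_eq]
    simp
  have hvar : ∀ i, ∫ ω, ξ i ω * ξ i ω ∂P = 1 := by
    intro i
    have h1 : Var[ξ i; P] = 1 := by
      rw [(hlaw i).variance_eq]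
      simp
    rw [variance_of_integral_eq_zero (mξ i).aemeasurable (hmean i)] at h1
    simpa [sq] using h1
  have hcov : ∀ i j, i ≠ j → ∫ ω, ξ i ω * ξ j ω ∂P = 0 := by
    intro i j hij
    have := (hind.indepFun hij).integral_mul_eq_mul_integral
      (mξ i).aestronglyMeasurable (mξ j).aestronglyMeasurable
    simpa [hmean] using this
  let e : w → Lp ℝ 2 P := fun i => (hL2 i).toLp (ξ i)
  have he : Orthonormal ℝ e := by
    rw [orthonormal_iff_ite]
    intro i j
    rw [L2.inner_def]
    have : ∫ ω, inner ℝ (e i ω) (e j ω) ∂P = ∫ ω, ξ i ω * ξ j ω ∂P := by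
      refine integral_congr_ae ?_
      filter_upwards [(hL2 i).coeFn_toLp, (hL2 j).coeFn_toLp] with ω h1 h2
      simp only [e, h1, h2]
      simp [mul_comm]
    rw [this]
    split_ifs with h
    · subst h; exact hvar i
    · exact hcov i j h
  -- The isometry expands `h` in the Hilbert basis and replaces the basis vectors by independent
  -- standard Gaussians.
  refine ⟨Ω, mΩ, P, hP, he.orthogonalFamily.linearIsometry.comp b.repr.toLinearIsometry, ?_⟩
  intro h
  have hsum := he.orthogonalFamily.hasSum_linearIsometry (b.repr h)
  -- By closedness only finite partial sums need checking, and these are linear images of jointly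
  -- Gaussian vectors.
  refine isClosed_isCenteredGaussianLp.mem_of_tendsto hsum (Eventually.of_forall fun s => ?_)
  have hae : ⇑(∑ i ∈ s, LinearIsometry.toSpanSingleton ℝ (Lp ℝ 2 P) (he.1 i) ((b.repr h) i))
      =ᵐ[P] fun ω => ∑ i : s, (b.repr h) i * ξ i ω := by
    have h1 : ∀ᵐ ω ∂P, ∀ i ∈ s, (e i) ω = ξ i ω := by
      rw [Finset.eventually_all]
      intro i _
      exact (hL2 i).coeFn_toLp
    have h2 := Lp.coeFn_finsetSum s fun i => (b.repr h) i • e i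
    have h3 : ∀ᵐ ω ∂P, ∀ i ∈ s, ((b.repr h) i • e i : Lp ℝ 2 P) ω = (b.repr h) i * e i ω := by
      rw [Finset.eventually_all]
      intro i _
      filter_upwards [Lp.coeFn_smul ((b.repr h) i) (e i)] with ω hω
      rw [hω]; rfl
    filter_upwards [h1, h2, h3] with ω h1 h2 h3
    rw [Finset.sum_coe_sort s fun i => (b.repr h) i * ξ i ω]
    simp only [LinearIsometry.toSpanSingleton_apply]
    rw [h2, Finset.sum_apply]
    exact Finset.sum_congr rfl fun i hi => by rw [h3 i hi, h1 i hi]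
  have hG : HasGaussianLaw (fun ω (i : s) => ξ i ω) P :=
    (hind.precomp (g := ((↑) : s → w)) Subtype.val_injective).hasGaussianLaw
      fun i => (hlaw i).hasGaussianLaw
  let L : (s → ℝ) →L[ℝ] ℝ := ∑ i : s, (b.repr h) i • ContinuousLinearMap.proj (R := ℝ) i
  have hLX : (fun ω => ∑ i : s, (b.repr h) i * ξ i ω) = fun ω => L (fun i => ξ i ω) := by
    ext ω
    simp [L]
  refine isCenteredGaussianLp_of_hasGaussianLaw ((hG.map_fun L).congr ?_) ?_
  · rw [← hLX]; exact hae.symm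
  · rw [integral_congr_ae hae, integral_finsetSum]
    · simp [integral_const_mul, hmean]
    · intro i _
      exact ((hL2 i).integrable (by norm_num)).const_mul _

/-! ### Positive definite kernels as Gram matrices and as Gaussian covariances -/

/-- Positive definite (symmetric, positive semidefinite) real kernels on a set. -/
structure IsPosDefKernel {ι : Type} (K : ι → ι → ℝ) : Prop where
  symm : ∀ i j, K i j = K j i
  nonneg : ∀ (s : Finset ι) (w : ι → ℝ), 0 ≤ ∑ i ∈ s, ∑ j ∈ s, w i * w j * K i j

/-- A positive definite kernel is a Gram matrix in a Hilbert space. -/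
lemma IsPosDefKernel.exists_feature {ι : Type} {K : ι → ι → ℝ} (hK : IsPosDefKernel K) :
    ∃ (H : Type) (_ : NormedAddCommGroup H) (_ : InnerProductSpace ℝ H) (_ : CompleteSpace H)
      (k : ι → H), ∀ i j, inner ℝ (k i) (k j) = K i j := by
  -- The scalar kernel is read as an operator-valued one on `ℝ`; the features are then the kernel
  -- functions applied to `1`.
  let M : Matrix ι ι (ℝ →L[ℝ] ℝ) := Matrix.of fun i j => K i j • ContinuousLinearMap.id ℝ ℝ
  have hM : M.PosSemidef := by
    have key : M.PosSemidef ↔ M.IsHermitian ∧ ∀ (v : ι →₀ ℝ),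
        0 ≤ RCLike.re (K := ℝ) (v.sum fun x w => v.sum fun x' w' => inner ℝ (M x' x w) w') :=
      RKHS.posSemidef_tfae.out 0 2
    refine key.mpr ⟨?_, fun v => ?_⟩
    · ext i j
      have : star (M j i) = M i j := by
        change star (K j i • (1 : ℝ →L[ℝ] ℝ)) = K i j • (1 : ℝ →L[ℝ] ℝ)
        rw [star_smul, star_one, hK.symm j i, star_trivial]
      rw [Matrix.conjTranspose_apply, this]
    · have := hK.nonneg v.support v
      simp only [Finsupp.sum, RCLike.re_to_real]
      convert this using 4 with i _ j _
      simp [M, hK.symm i j]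
      ring
  have : Fact M.PosSemidef := ⟨hM⟩
  refine ⟨RKHS.OfKernel M, inferInstance, inferInstance, inferInstance,
    fun i => RKHS.kerFun (RKHS.OfKernel M) i 1, fun i j => ?_⟩
  rw [← RKHS.kernel_inner (RKHS.OfKernel M) j i, RKHS.OfKernel.kernel_ofKernel]
  simp [M, hK.symm i j]

/-- Every positive definite kernel is the covariance of a centred Gaussian process. -/
lemma IsPosDefKernel.exists_gaussianProcess {ι : Type} {K : ι → ι → ℝ} (hK : IsPosDefKernel K) :
    ∃ (Ω : Type) (_ : MeasurableSpace Ω) (P : Measure Ω) (_ : IsProbabilityMeasure P)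
      (X : ι → Ω → ℝ), IsGaussianProcess X P ∧ (∀ i, MemLp (X i) 2 P) ∧
        (∀ i, ∫ ω, X i ω ∂P = 0) ∧ ∀ i j, covariance (X i) (X j) P = K i j := by
  classical
  obtain ⟨H, _, _, _, k, hk⟩ := hK.exists_feature
  obtain ⟨Ω, mΩ, P, hP, Φ, hΦ⟩ := exists_isonormal H
  have mΦ : ∀ h, AEMeasurable (Φ h) P := fun h => (Lp.aestronglyMeasurable _).aemeasurable
  have hmean : ∀ i, ∫ ω, Φ (k i) ω ∂P = 0 := by
    intro i
    have h1 := integral_map (mΦ (k i)) (f := id) (by fun_prop)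
    simp only [id] at h1
    rw [← h1, (hΦ (k i)).map_eq]
    exact integral_id_gaussianReal
  refine ⟨Ω, mΩ, P, hP, fun i => Φ (k i), ⟨fun I => ⟨?_⟩⟩, fun i => Lp.memLp _, hmean, ?_⟩
  · have mX : AEMeasurable (fun ω => I.restrict fun i => Φ (k i) ω) P :=
      aemeasurable_pi_lambda _ fun i => mΦ _
    have := Measure.isProbabilityMeasure_map (μ := P) mX
    refine isGaussian_of_map_eq_gaussianReal fun L => ?_
    -- A linear functional of the finite-dimensional vector is almost surely `Φ` of the same
    -- combination of features, hence Gaussian. This holds for every functional, so the vector is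
    -- Gaussian.
    refine ⟨0, _, Eq.trans ?_ (hΦ (∑ i : I, L (Pi.single i 1) • k i)).map_eq⟩
    rw [AEMeasurable.map_map_of_aemeasurable (by fun_prop) mX]
    refine Measure.map_congr ?_
    have h2 := Lp.coeFn_finsetSum (Finset.univ : Finset I)
      fun i => L (Pi.single i 1) • Φ (k i)
    have h3 : ∀ᵐ ω ∂P, ∀ i ∈ (Finset.univ : Finset I),
        (L (Pi.single i 1) • Φ (k i) : Lp ℝ 2 P) ω = L (Pi.single i 1) * Φ (k i) ω := by
      rw [Finset.eventually_all]
      intro i _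
      filter_upwards [Lp.coeFn_smul (L (Pi.single i 1)) (Φ (k i))] with ω hω
      rw [hω]; rfl
    filter_upwards [h2, h3] with ω h2 h3
    simp only [map_sum, map_smul]
    rw [h2, Finset.sum_apply, Finset.sum_congr rfl h3, Function.comp_apply,
      ← LinearMap.sum_single_apply (fun _ : I => ℝ) (I.restrict fun i => Φ (k i) ω),
      map_sum]
    refine Finset.sum_congr rfl fun i _ => ?_
    have : (Pi.single i (I.restrict (fun i => Φ (k i) ω) i) : I → ℝ)
        = (Φ (k i) ω) • (Pi.single i 1 : I → ℝ) := by
      ext j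
      by_cases h : j = i
      · subst h; simp
      · simp [h]
    rw [this, map_smul, smul_eq_mul, mul_comm]
  · intro i j
    rw [covariance, hmean, hmean, ← hk i j, ← Φ.inner_map_map, L2.inner_def]
    refine integral_congr_ae (ae_of_all _ fun ω => ?_)
    simp [mul_comm]

/-- Covariances of square-integrable variables form a positive definite kernel. -/
lemma isPosDefKernel_covariance {Ω ι : Type} [MeasurableSpace Ω] {P : Measure Ω}
    [IsProbabilityMeasure P] {X : ι → Ω → ℝ} (hX : ∀ i, MemLp (X i) 2 P) :
    IsPosDefKernel fun i j => covariance (X i) (X j) P := by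
  refine ⟨fun i j => covariance_comm _ _, fun s w => ?_⟩
  have h1 : ∀ i, MemLp (w i • X i) 2 P := fun i => (hX i).const_smul _
  have h2 : 0 ≤ Var[∑ i ∈ s, w i • X i; P] := variance_nonneg _ _
  rw [← covariance_self (memLp_finsetSum' s fun i _ => h1 i).aemeasurable,
    covariance_sum_sum' (fun i _ => h1 i) (fun i _ => h1 i)] at h2
  convert h2 using 4 with i _ j _
  rw [covariance_smul_left, covariance_smul_right]
  ring

/-! ### Covariance matrix functions as scalar kernels -/

/-- The kernel on `T × Fin m` attached to a stationary matrix function. -/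
def stationaryKernel {T : Type} [AddCommGroup T] {m : ℕ} (B : T → Matrix (Fin m) (Fin m) ℝ)
    (p q : T × Fin m) : ℝ :=
  B (p.1 - q.1) p.2 q.2

/-- The kernel on `(S^d × T) × Fin m` attached to an isotropic stationary matrix function. -/
noncomputable def isotropicKernel {T : Type} [AddCommGroup T] {m : ℕ} (d : ℕ)
    (C : ℝ → T → Matrix (Fin m) (Fin m) ℝ) (p q : (UnitSphere d × T) × Fin m) : ℝ :=
  C (sphericalDist p.1.1 q.1.1) (p.1.2 - q.1.2) p.2 q.2

/-- Adding the component to the index turns the matrix-valued condition into a scalar one; the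
centred Gaussian process of the kernel supplies the witness. -/
lemma isStationaryCovFun_iff {T : Type} [AddCommGroup T] {m : ℕ}
    (B : T → Matrix (Fin m) (Fin m) ℝ) :
    IsStationaryCovFun B ↔ IsPosDefKernel (stationaryKernel B) := by
  constructor
  · rintro ⟨Ω, mΩ, P, hP, V, hV, hB⟩
    have := isPosDefKernel_covariance (P := P) (X := fun (p : T × Fin m) ω => V p.1 ω p.2)
      fun p => hV.memLp _ _
    convert this using 3 with p q
    rw [stationaryKernel, ← hB]
    rfl
  · intro hK
    obtain ⟨Ω, mΩ, P, hP, X, -, h2, h0, hc⟩ := hK.exists_gaussianProcess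
    refine ⟨Ω, mΩ, P, hP, fun t ω i => X (t, i) ω, ⟨fun t i => h2 _, 0, fun t i => h0 _⟩,
      fun t₁ t₂ => ?_⟩
    ext i j
    exact hc _ _

lemma HasIsotropicStationaryCov.isPosDefKernel {Ω : Type} [MeasurableSpace Ω] {T : Type}
    [AddCommGroup T] {m d : ℕ} {Z : UnitSphere d × T → Ω → Fin m → ℝ} {P : Measure Ω}
    [IsProbabilityMeasure P] {C : ℝ → T → Matrix (Fin m) (Fin m) ℝ}
    (hZ : HasIsotropicStationaryCov Z P C) : IsPosDefKernel (isotropicKernel d C) := by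
  have := isPosDefKernel_covariance (P := P)
    (X := fun (p : (UnitSphere d × T) × Fin m) ω => Z p.1 ω p.2) fun p => hZ.secondOrder.memLp _ _
  convert this using 3 with p q
  rw [isotropicKernel, ← hZ.cov_eq]
  rfl

/-- Only second moments enter the forward direction; Gaussianity comes for free in the converse. -/
lemma isCovFunOfGaussianField_iff {T : Type} [AddCommGroup T] {m d : ℕ}
    (C : ℝ → T → Matrix (Fin m) (Fin m) ℝ) :
    IsCovFunOfGaussianField d C ↔ IsPosDefKernel (isotropicKernel d C) := by
  constructor
  · rintro ⟨Ω, mΩ, P, hP, Z, -, hZ⟩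
    exact hZ.isPosDefKernel
  · intro hK
    obtain ⟨Ω, mΩ, P, hP, X, hG, h2, h0, hc⟩ := hK.exists_gaussianProcess
    refine ⟨Ω, mΩ, P, hP, fun p ω i => X (p, i) ω, ?_,
      ⟨⟨fun t i => h2 _, 0, fun t i => h0 _⟩, fun x₁ x₂ t₁ t₂ => ?_⟩⟩
    · classical
      -- The vector at `p` is a linear image of the finitely many scalar variables indexed by `(p,
      -- i)`.
      refine hG.of_isGaussianProcess fun p => ⟨Finset.univ.image fun i => (p, i),
        ContinuousLinearMap.pi fun i => ContinuousLinearMap.proj ⟨(p, i), by simp⟩, fun ω => ?_⟩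
      ext i
      simp
    · ext i j
      exact hc _ _

/-- Gaussian vectors are elliptically contoured. -/
lemma isEllipticallyContoured_of_hasGaussianLaw {Ω : Type} [MeasurableSpace Ω] {κ : Type}
    [Fintype κ] {X : Ω → EuclideanSpace ℝ κ} {P : Measure Ω} (hX : HasGaussianLaw X P) :
    IsEllipticallyContoured X P := by
  classical
  have := hX.isGaussian_map
  have hquad : ∀ u : κ → ℝ, u ⬝ᵥ (Matrix.of fun i j =>
      covarianceBilin (P.map X) (EuclideanSpace.basisFun κ ℝ i)
        (EuclideanSpace.basisFun κ ℝ j)).mulVec u =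
      covarianceBilin (P.map X) (WithLp.toLp 2 u) (WithLp.toLp 2 u) := by
    intro u
    have hu : (WithLp.toLp 2 u : EuclideanSpace ℝ κ)
        = ∑ i, u i • EuclideanSpace.basisFun κ ℝ i := by
      conv_lhs => rw [← (EuclideanSpace.basisFun κ ℝ).sum_repr (WithLp.toLp 2 u)]
      simp
    conv_rhs => rw [hu]
    simp only [map_sum, map_smul, sum_apply, smul_apply, dotProduct, Matrix.mulVec,
      Matrix.of_apply, smul_eq_mul, Finset.mul_sum]
    refine Finset.sum_comm.trans ?_
    refine Finset.sum_congr rfl fun i _ => Finset.sum_congr rfl fun j _ => ?_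
    ring
  refine ⟨hX.aemeasurable, ∫ x, x ∂(P.map X),
    Matrix.of fun i j => covarianceBilin (P.map X) (EuclideanSpace.basisFun κ ℝ i)
      (EuclideanSpace.basisFun κ ℝ j), fun s => Real.exp (-s / 2), ?_, fun u => ?_⟩
  · refine Matrix.PosSemidef.of_dotProduct_mulVec_nonneg ?_ fun u => ?_
    · ext i j
      simp [Matrix.conjTranspose_apply, covarianceBilin_comm]
    · rw [star_trivial, hquad]
      exact covarianceBilin_self_nonneg _
  · rw [IsGaussian.charFun_eq', hquad, sub_eq_add_neg, Complex.exp_add]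
    congr 1
    push_cast
    congr 1
    simp [neg_div]

lemma isEllipticallyContouredField_of_isGaussianProcess {Ω : Type} [MeasurableSpace Ω] {ι : Type}
    {m : ℕ} {Z : ι → Ω → Fin m → ℝ} {P : Measure Ω} (hZ : IsGaussianProcess Z P) :
    IsEllipticallyContouredField Z P := by
  intro I
  refine isEllipticallyContoured_of_hasGaussianLaw ?_
  let L : (I → Fin m → ℝ) →L[ℝ] (I × Fin m → ℝ) :=
    ContinuousLinearMap.pi fun q =>
      (ContinuousLinearMap.proj (R := ℝ) (φ := fun _ : Fin m => ℝ) q.2).comp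
        (ContinuousLinearMap.proj (R := ℝ) (φ := fun _ : I => Fin m → ℝ) q.1)
  exact ((hZ.hasGaussianLaw I).map_fun L).map_equiv_fun
    (PiLp.continuousLinearEquiv 2 ℝ (fun _ : I × Fin m => ℝ)).symm

/-- The criterion is the same as for Gaussian fields: necessity ignores the distribution, and a
Gaussian field is already an elliptical witness. -/
lemma isCovFunOfEllipticalField_iff {T : Type} [AddCommGroup T] {m d : ℕ}
    (C : ℝ → T → Matrix (Fin m) (Fin m) ℝ) :
    IsCovFunOfEllipticalField d C ↔ IsPosDefKernel (isotropicKernel d C) := by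
  constructor
  · rintro ⟨Ω, mΩ, P, hP, Z, -, hZ⟩
    exact hZ.isPosDefKernel
  · intro hK
    obtain ⟨Ω, mΩ, P, hP, Z, hG, hZ⟩ := (isCovFunOfGaussianField_iff C).2 hK
    exact ⟨Ω, mΩ, P, hP, Z, isEllipticallyContouredField_of_isGaussianProcess hG, hZ⟩

/-! ### Zonal polynomials, the zonal Laplacian and its maximum principle -/

open Polynomial in
/-- The Gegenbauer polynomials of the sphere `S^d`, normalised to take the value `1` at `1`. -/
noncomputable def zonalPoly (d : ℕ) : ℕ → Polynomial ℝ
  | 0 => 1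
  | 1 => X
  | n + 2 => C ((n + d : ℝ)⁻¹) *
      (C (2 * n + d + 1 : ℝ) * X * zonalPoly d (n + 1) - C (n + 1 : ℝ) * zonalPoly d n)

/-- The eigenvalues `n (n + d - 1)` of the Laplacian on `S^d`. -/
def laplaceEigenvalue (d n : ℕ) : ℝ := n * (n + d - 1)

section
open Polynomial

/-- The zonal part of the Laplacian on `S^d`, acting on polynomials in the height coordinate. -/
noncomputable def zonalLaplacian (d : ℕ) (u : ℝ[X]) : ℝ[X] :=
  (1 - X ^ 2) * derivative (derivative u) - C (d : ℝ) * X * derivative u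

variable {d : ℕ}

lemma zonalPoly_rec (hd : 1 ≤ d) (n : ℕ) :
    C (n + d : ℝ) * zonalPoly d (n + 2) =
      C (2 * n + d + 1 : ℝ) * X * zonalPoly d (n + 1) - C (n + 1 : ℝ) * zonalPoly d n := by
  have h : (n + d : ℝ) ≠ 0 := by positivity
  rw [zonalPoly, ← mul_assoc, ← C_mul, mul_inv_cancel₀ h, C_1, one_mul]

lemma zonalPoly_eval_one (hd : 1 ≤ d) (n : ℕ) : (zonalPoly d n).eval 1 = 1 := by
  induction n using Nat.twoStepInduction with
  | zero => simp [zonalPoly]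
  | one => simp [zonalPoly]
  | more n h0 h1 =>
    have h := congrArg (eval 1) (zonalPoly_rec hd n)
    simp only [eval_mul, eval_C, eval_sub, eval_X, h0, h1] at h
    have h' : (n + d : ℝ) ≠ 0 := by positivity
    apply mul_left_cancel₀ h'
    rw [h]; ring

lemma zonalPoly_natDegree_le (n : ℕ) : (zonalPoly d n).natDegree ≤ n := by
  induction n using Nat.twoStepInduction with
  | zero => simp [zonalPoly]
  | one => simp [zonalPoly]
  | more n h0 h1 =>
    rw [zonalPoly]
    refine (natDegree_C_mul_le _ _).trans ((natDegree_sub_le _ _).trans (max_le ?_ ?_))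
    · rw [mul_assoc]
      refine (natDegree_C_mul_le _ _).trans (natDegree_mul_le.trans ?_)
      rw [natDegree_X]
      omega
    · exact (natDegree_C_mul_le _ _).trans (by omega)

/-- A nonzero top coefficient is what lets the product formula match a polynomial of degree at most
`n` against a multiple of `zonalPoly d n`. -/
lemma zonalPoly_coeff_pos (hd : 1 ≤ d) (n : ℕ) : 0 < (zonalPoly d n).coeff n := by
  induction n using Nat.twoStepInduction with
  | zero => simp [zonalPoly]
  | one => simp [zonalPoly]
  | more n h0 h1 =>
    have h2 : (zonalPoly d n).coeff (n + 2) = 0 :=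
      coeff_eq_zero_of_natDegree_lt (by have := zonalPoly_natDegree_le (d := d) n; omega)
    rw [zonalPoly, coeff_C_mul, coeff_sub, mul_assoc, coeff_C_mul, coeff_C_mul, h2, mul_zero,
      sub_zero, coeff_X_mul]
    positivity

/-- These are the two ladder relations. They are proved jointly: the second at `n + 1` is the first
at `n` combined with the recurrence, and the first at `n + 1` comes from differentiating the
recurrence. -/
lemma one_sub_sq_mul_derivative_zonalPoly (hd : 1 ≤ d) (n : ℕ) :
    ((1 - X ^ 2) * derivative (zonalPoly d (n + 1))
      = C (n + 1 : ℝ) * (zonalPoly d n - X * zonalPoly d (n + 1))) ∧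
    ((1 - X ^ 2) * derivative (zonalPoly d n)
      = C (n + d - 1 : ℝ) * (X * zonalPoly d n - zonalPoly d (n + 1))) := by
  induction n with
  | zero => constructor <;> simp [zonalPoly, pow_two]
  | succ n ih =>
    obtain ⟨hA, hB⟩ := ih
    have hr := zonalPoly_rec hd n
    have hr' := congrArg derivative hr
    have hc : (C (n + d : ℝ)) ≠ 0 := by
      rw [Ne, C_eq_zero]; positivity
    simp only [map_add, map_sub, map_mul, map_one, map_natCast, map_ofNat, derivative_mul,
      derivative_natCast, derivative_one, derivative_X, derivative_ofNat, Nat.cast_add,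
      Nat.cast_one] at hA hB hr hr' hc ⊢
    constructor
    · apply mul_left_cancel₀ hc
      linear_combination (1 - X ^ 2) * hr' + (2 * (n : ℝ[X]) + d + 1) * X * hA
        - ((n : ℝ[X]) + 1) * hB + ((n : ℝ[X]) + 2) * X * hr
    · linear_combination hA + hr

/-- Differentiating one ladder relation and eliminating with the other gives the eigenvalue equation
multiplied by `1 - X ^ 2`, which is then cancelled. -/
lemma zonalLaplacian_zonalPoly (hd : 1 ≤ d) (n : ℕ) :
    zonalLaplacian d (zonalPoly d n) = C (-laplaceEigenvalue d n) * zonalPoly d n := by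
  cases n with
  | zero => simp [zonalLaplacian, zonalPoly, laplaceEigenvalue]
  | succ n =>
    obtain ⟨hA, hB⟩ := one_sub_sq_mul_derivative_zonalPoly hd n
    have hA' := congrArg derivative hA
    have h1 : (1 - X ^ 2 : ℝ[X]) ≠ 0 := by
      intro h
      simpa using congrArg (eval 0) h
    simp only [zonalLaplacian, laplaceEigenvalue]
    simp only [map_add, map_sub, map_mul, map_one, map_natCast, derivative_mul,
      derivative_natCast, derivative_one, derivative_X, Nat.cast_add,
      Nat.cast_one, derivative_X_pow, map_neg] at hA hA' hB ⊢
    apply mul_left_cancel₀ h1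
    push_cast at hA'
    linear_combination (1 - X ^ 2) * hA' + ((n : ℝ[X]) + 1) * hB
      + (1 - (d : ℝ[X]) - n) * X * hA

lemma zonalLaplacian_sum (hd : 1 ≤ d) (s : Finset ℕ) (c : ℕ → ℝ) :
    zonalLaplacian d (∑ n ∈ s, C (c n) * zonalPoly d n) =
      ∑ n ∈ s, C (-laplaceEigenvalue d n * c n) * zonalPoly d n := by
  have h : ∀ n ∈ s, C (-laplaceEigenvalue d n * c n) * zonalPoly d n
      = C (c n) * zonalLaplacian d (zonalPoly d n) := by
    intro n _
    rw [zonalLaplacian_zonalPoly hd, C_mul]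
    ring
  rw [Finset.sum_congr rfl h]
  simp only [zonalLaplacian, derivative_sum, derivative_C_mul, Finset.mul_sum,
    ← Finset.sum_sub_distrib]
  refine Finset.sum_congr rfl fun n _ => ?_
  ring

lemma eval_nonpos_of_right {r : ℝ[X]} {x b : ℝ} (hb : x < b)
    (h : ∀ y ∈ Set.Ioo x b, r.eval y ≤ 0) : r.eval x ≤ 0 := by
  have ht : Tendsto (fun y => r.eval y) (𝓝[>] x) (𝓝 (r.eval x)) :=
    r.continuous.continuousAt.tendsto.mono_left nhdsWithin_le_nhds
  refine le_of_tendsto ht ?_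
  filter_upwards [Ioo_mem_nhdsGT hb] with y hy using h y hy

lemma eval_nonpos_of_left {r : ℝ[X]} {x b : ℝ} (hb : b < x)
    (h : ∀ y ∈ Set.Ioo b x, r.eval y ≤ 0) : r.eval x ≤ 0 := by
  have ht : Tendsto (fun y => r.eval y) (𝓝[<] x) (𝓝 (r.eval x)) :=
    r.continuous.continuousAt.tendsto.mono_left nhdsWithin_le_nhds
  refine le_of_tendsto ht ?_
  filter_upwards [Ioo_mem_nhdsLT hb] with y hy using h y hy

/-- The maximum principle for the zonal Laplacian. -/
lemma zonalLaplacian_eval_nonpos {u : ℝ[X]} {x : ℝ} (hx : x ∈ Set.Icc (-1 : ℝ) 1)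
    (hmax : ∀ y ∈ Set.Icc (-1 : ℝ) 1, u.eval y ≤ u.eval x) :
    (zonalLaplacian d u).eval x ≤ 0 := by
  -- This is the derivative test done algebraically: `q` is the difference quotient at `x`, so `q x`
  -- is the first derivative and twice `q' x` the second.
  obtain ⟨q, hq⟩ : X - C x ∣ u - C (u.eval x) := by
    rw [dvd_iff_isRoot]; simp
  have hu : u = C (u.eval x) + (X - C x) * q := by rw [← hq]; ring
  have hqy : ∀ y ∈ Set.Icc (-1 : ℝ) 1, (y - x) * q.eval y ≤ 0 := by
    intro y hy
    have h1 := congrArg (eval y) hq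
    simp only [eval_sub, eval_C, eval_mul, eval_X] at h1
    linarith [hmax y hy]
  have hL : (zonalLaplacian d u).eval x
      = (1 - x ^ 2) * (2 * (derivative q).eval x) - d * x * q.eval x := by
    have h1 : derivative u = q + (X - C x) * derivative q := by
      conv_lhs => rw [hu]
      simp
    have h2 : derivative (derivative u)
        = 2 * derivative q + (X - C x) * derivative (derivative q) := by
      rw [h1]
      simp
      ring
    rw [zonalLaplacian, h2, h1]
    simp only [eval_sub, eval_mul, eval_add, eval_one, eval_pow, eval_X, eval_C, eval_ofNat]
    ring
  have hright : x < 1 → q.eval x ≤ 0 := fun h =>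
    eval_nonpos_of_right h fun y hy => by
      have := hqy y ⟨hx.1.trans hy.1.le, hy.2.le⟩
      nlinarith [hy.1]
  have hleft : -1 < x → 0 ≤ q.eval x := fun h => by
    have := eval_nonpos_of_left (r := -q) h fun y hy => by
      have := hqy y ⟨hy.1.le, hy.2.le.trans hx.2⟩
      rw [eval_neg]
      nlinarith [hy.2]
    rw [eval_neg] at this
    linarith
  rw [hL]
  have hd0 : (0 : ℝ) ≤ d := Nat.cast_nonneg d
  -- At the endpoints the second-order coefficient `1 - x²` vanishes and the one-sided sign of the
  -- first derivative suffices; in the interior the first derivative vanishes and the second is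
  -- nonpositive.
  rcases eq_or_lt_of_le hx.1 with h1 | h1
  · subst h1
    have := mul_nonneg hd0 (neg_nonneg.2 (hright (by norm_num)))
    linarith
  rcases eq_or_lt_of_le hx.2 with h2 | h2
  · subst h2
    have := mul_nonneg hd0 (hleft (by norm_num))
    linarith
  have hq0 : q.eval x = 0 := le_antisymm (hright h2) (hleft h1)
  obtain ⟨r, hr⟩ : X - C x ∣ q := by rw [dvd_iff_isRoot]; exact hq0
  have hr0 : r.eval x ≤ 0 := eval_nonpos_of_right h2 fun y hy => by
    have h3 := hqy y ⟨hx.1.trans hy.1.le, hy.2.le⟩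
    rw [hr, eval_mul, eval_sub, eval_X, eval_C, ← mul_assoc] at h3
    have : 0 < (y - x) * (y - x) := by nlinarith [hy.1]
    by_contra hcon
    push Not at hcon
    linarith [mul_pos this hcon]
  have hq' : (derivative q).eval x = r.eval x := by rw [hr]; simp
  rw [hq', hq0]
  have h4 : 0 < 1 - x ^ 2 := by nlinarith
  nlinarith

lemma laplaceEigenvalue_nonneg (hd : 1 ≤ d) (n : ℕ) : 0 ≤ laplaceEigenvalue d n := by
  have : (1 : ℝ) ≤ d := by exact_mod_cast hd
  exact mul_nonneg (Nat.cast_nonneg n) (by linarith [(Nat.cast_nonneg n : (0 : ℝ) ≤ n)])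

/-- The resolvent of the zonal Laplacian preserves upper bounds. -/
lemma resolvent_sum_le (hd : 1 ≤ d) {s M : ℝ} (hs : 0 ≤ s) (t : Finset ℕ) (a : ℕ → ℝ)
    (h : ∀ x ∈ Set.Icc (-1 : ℝ) 1, ∑ n ∈ t, a n * (zonalPoly d n).eval x ≤ M) :
    ∀ x ∈ Set.Icc (-1 : ℝ) 1,
      ∑ n ∈ t, a n / (1 + s * laplaceEigenvalue d n) * (zonalPoly d n).eval x ≤ M := by
  set u : ℝ[X] := ∑ n ∈ t, C (a n / (1 + s * laplaceEigenvalue d n)) * zonalPoly d n with hu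
  have hue : ∀ x, u.eval x
      = ∑ n ∈ t, a n / (1 + s * laplaceEigenvalue d n) * (zonalPoly d n).eval x := by
    intro x
    simp [hu, eval_finsetSum]
  obtain ⟨y, hy, hmax⟩ := isCompact_Icc.exists_isMaxOn (Set.nonempty_Icc.2 (by norm_num))
    (u.continuous.continuousOn (s := Set.Icc (-1 : ℝ) 1))
  have hL := zonalLaplacian_eval_nonpos (d := d) hy fun z hz => hmax hz
  intro x hx
  rw [← hue]
  refine le_trans (b := u.eval y) (hmax hx) ?_
  -- The polynomial `u` solves `u - s L u = ∑ a_n p_n`, and `L u ≤ 0` at a maximum point `y`.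
  have key : u.eval y = ∑ n ∈ t, a n * (zonalPoly d n).eval y
      + s * (zonalLaplacian d u).eval y := by
    rw [hue, hu, zonalLaplacian_sum hd, eval_finsetSum, Finset.mul_sum,
      ← Finset.sum_add_distrib]
    refine Finset.sum_congr rfl fun n _ => ?_
    have : (1 + s * laplaceEigenvalue d n) ≠ 0 := by
      have := mul_nonneg hs (laplaceEigenvalue_nonneg hd n)
      positivity
    simp only [eval_mul, eval_C]
    field_simp
    ring
  rw [key]
  nlinarith [h y hy]

end

/-! ### Gaussian integrals and moments of coordinates on the sphere -/

/-- Integrating this derivative over the line and over the half-line gives the two-step moment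
recursions. -/
lemma hasDerivAt_pow_mul_exp_neg_sq (k : ℕ) (x : ℝ) :
    HasDerivAt (fun x : ℝ => x ^ (k + 1) * Real.exp (-x ^ 2 / 2))
      ((k + 1) * (x ^ k * Real.exp (-x ^ 2 / 2)) - x ^ (k + 2) * Real.exp (-x ^ 2 / 2)) x := by
  have h1 : HasDerivAt (fun x : ℝ => x ^ (k + 1)) ((k + 1) * x ^ k) x := by
    simpa using hasDerivAt_pow (k + 1) x
  have h2 : HasDerivAt (fun x : ℝ => Real.exp (-x ^ 2 / 2))
      (Real.exp (-x ^ 2 / 2) * (-(2 * x) / 2)) x := by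
    have := ((hasDerivAt_pow 2 x).neg.div_const 2).exp
    simpa using this
  refine (h1.mul h2).congr_deriv ?_
  ring

lemma integrable_pow_mul_exp_neg_sq (k : ℕ) :
    Integrable fun x : ℝ => x ^ k * Real.exp (-x ^ 2 / 2) := by
  have := integrable_rpow_mul_exp_neg_mul_sq (b := 1 / 2) (by norm_num) (s := k)
    (by have : (0 : ℝ) ≤ k := Nat.cast_nonneg k
        linarith)
  convert this using 3 with x
  · rw [Real.rpow_natCast]
  · congr 1; ring

/-- The (unnormalised) moments of the standard Gaussian. -/
noncomputable def gaussMoment (k : ℕ) : ℝ := ∫ x : ℝ, x ^ k * Real.exp (-x ^ 2 / 2)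

/-- The (unnormalised) moments of the half-line Gaussian. -/
noncomputable def radialMoment (k : ℕ) : ℝ :=
  ∫ x in Set.Ioi (0 : ℝ), x ^ k * Real.exp (-x ^ 2 / 2)

lemma gaussMoment_add_two (k : ℕ) : gaussMoment (k + 2) = (k + 1) * gaussMoment k := by
  have h := integral_eq_zero_of_hasDerivAt_of_integrable
    (hasDerivAt_pow_mul_exp_neg_sq k)
    (((integrable_pow_mul_exp_neg_sq k).const_mul _).sub (integrable_pow_mul_exp_neg_sq (k + 2)))
    (integrable_pow_mul_exp_neg_sq (k + 1))
  rw [integral_sub ((integrable_pow_mul_exp_neg_sq k).const_mul _)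
    (integrable_pow_mul_exp_neg_sq (k + 2)), integral_const_mul] at h
  simp only [gaussMoment]
  linarith

lemma gaussMoment_one : gaussMoment 1 = 0 := by
  have h : ∫ x : ℝ, (-x) ^ 1 * Real.exp (-(-x) ^ 2 / 2) = ∫ x : ℝ, x ^ 1 * Real.exp (-x ^ 2 / 2) :=
    integral_neg_eq_self (fun x : ℝ => x ^ 1 * Real.exp (-x ^ 2 / 2)) volume
  have h2 : ∫ x : ℝ, (-x) ^ 1 * Real.exp (-(-x) ^ 2 / 2)
      = - ∫ x : ℝ, x ^ 1 * Real.exp (-x ^ 2 / 2) := by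
    rw [← integral_neg]
    simp
  simp only [gaussMoment]
  linarith

lemma radialMoment_add_two (k : ℕ) : radialMoment (k + 2) = (k + 1) * radialMoment k := by
  have hi : IntegrableOn (fun x : ℝ => (k + 1) * (x ^ k * Real.exp (-x ^ 2 / 2))
      - x ^ (k + 2) * Real.exp (-x ^ 2 / 2)) (Set.Ioi 0) :=
    (((integrable_pow_mul_exp_neg_sq k).const_mul _).sub
      (integrable_pow_mul_exp_neg_sq (k + 2))).integrableOn
  have ht := tendsto_zero_of_hasDerivAt_of_integrableOn_Ioi (a := (0 : ℝ))
    (fun x _ => hasDerivAt_pow_mul_exp_neg_sq k x) hi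
    (integrable_pow_mul_exp_neg_sq (k + 1)).integrableOn
  have h := integral_Ioi_of_hasDerivAt_of_tendsto' (a := (0 : ℝ))
    (fun x _ => hasDerivAt_pow_mul_exp_neg_sq k x) hi ht
  rw [integral_sub ((integrable_pow_mul_exp_neg_sq k).const_mul _).integrableOn
    (integrable_pow_mul_exp_neg_sq (k + 2)).integrableOn, integral_const_mul] at h
  simp only [radialMoment]
  simp at h
  linarith

lemma radialMoment_pos (k : ℕ) : 0 < radialMoment k := by
  refine (setIntegral_pos_iff_support_of_nonneg_ae ?_
    (integrable_pow_mul_exp_neg_sq k).integrableOn).2 ?_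
  · refine (ae_restrict_iff' measurableSet_Ioi).2 (ae_of_all _ fun x hx => ?_)
    have : (0 : ℝ) < x := hx
    simp only [Pi.zero_apply]
    positivity
  · have : Set.Ioi (0 : ℝ) ⊆ (Function.support fun x : ℝ => x ^ k * Real.exp (-x ^ 2 / 2))
        ∩ Set.Ioi 0 := by
      intro x hx
      have h0 : (0 : ℝ) < x := hx
      refine ⟨?_, hx⟩
      rw [Function.mem_support]
      positivity
    refine lt_of_lt_of_le ?_ (measure_mono this)
    simp

/-- The surface measure on the unit sphere. -/
noncomputable def sphereMeasure (d : ℕ) : Measure (UnitSphere d) :=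
  (volume : Measure (EuclideanSpace ℝ (Fin (d + 1)))).toSphere

instance (d : ℕ) : IsFiniteMeasure (sphereMeasure d) := by
  unfold sphereMeasure; infer_instance

instance (d : ℕ) : (sphereMeasure d).IsOpenPosMeasure := by
  unfold sphereMeasure; infer_instance

/-- Integration of a homogeneous function against a Gaussian weight in polar coordinates. -/
lemma integral_homogeneous_mul_exp {d k : ℕ} (F : EuclideanSpace ℝ (Fin (d + 1)) → ℝ)
    (hF : ∀ (r : ℝ) (x), 0 < r → F (r • x) = r ^ k * F x) :
    ∫ x, F x * Real.exp (-‖x‖ ^ 2 / 2)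
      = (∫ z : UnitSphere d, F z ∂(sphereMeasure d)) * radialMoment (k + d) := by
  set μ : Measure (EuclideanSpace ℝ (Fin (d + 1))) := volume
  have hdim : Module.finrank ℝ (EuclideanSpace ℝ (Fin (d + 1))) - 1 = d := by simp
  calc ∫ x, F x * Real.exp (-‖x‖ ^ 2 / 2) ∂μ
      = ∫ x : ({(0)}ᶜ : Set (EuclideanSpace ℝ (Fin (d + 1)))),
          F x * Real.exp (-‖x.1‖ ^ 2 / 2) ∂(μ.comap (↑)) := by
        rw [integral_subtype_comap (measurableSet_singleton _).compl
          fun x => F x * Real.exp (-‖x‖ ^ 2 / 2), restrict_compl_singleton]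
    _ = ∫ p : UnitSphere d × Set.Ioi (0 : ℝ), F p.1 * (p.2.1 ^ k * Real.exp (-p.2.1 ^ 2 / 2))
          ∂(μ.toSphere.prod (.volumeIoiPow d)) := by
        have := μ.measurePreserving_homeomorphUnitSphereProd.integral_comp
          (Homeomorph.measurableEmbedding _)
          (fun p : UnitSphere d × Set.Ioi (0 : ℝ) =>
            F p.1 * (p.2.1 ^ k * Real.exp (-p.2.1 ^ 2 / 2)))
        rw [hdim] at this
        rw [← this]
        refine integral_congr_ae (ae_of_all _ fun x => ?_)
        have hx : 0 < ‖x.1‖ := norm_pos_iff.2 x.2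
        have h1 := hF ‖x.1‖ (‖x.1‖⁻¹ • x.1) hx
        rw [smul_smul, mul_inv_cancel₀ hx.ne', one_smul] at h1
        simp only [homeomorphUnitSphereProd_apply_snd_coe, homeomorphUnitSphereProd_apply_fst_coe]
        rw [h1]
        ring
    _ = (∫ z : UnitSphere d, F z ∂(sphereMeasure d)) *
          ∫ r : Set.Ioi (0 : ℝ), r.1 ^ k * Real.exp (-r.1 ^ 2 / 2) ∂(.volumeIoiPow d) :=
        integral_prod_mul (fun z : UnitSphere d => F z)
          (fun r : Set.Ioi (0 : ℝ) => r.1 ^ k * Real.exp (-r.1 ^ 2 / 2))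
    _ = _ := by
      congr 1
      simp only [Measure.volumeIoiPow, ENNReal.ofReal]
      rw [integral_withDensity_eq_integral_smul,
        integral_subtype_comap measurableSet_Ioi
          fun a : ℝ => Real.toNNReal (a ^ d) • (a ^ k * Real.exp (-a ^ 2 / 2)), radialMoment]
      · refine setIntegral_congr_fun measurableSet_Ioi fun x hx => ?_
        rw [NNReal.smul_def, Real.coe_toNNReal _ (pow_nonneg hx.out.le _), smul_eq_mul]
        ring
      · exact (measurable_subtype_coe.pow_const _).real_toNNReal

/-- In an orthonormal basis extending `e, f` the Gaussian weight factorises into one-dimensional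
integrals; the other `d - 1` coordinates contribute only masses. -/
lemma integral_inner_pow_mul_exp {d : ℕ} (hd : 1 ≤ d) {e f : EuclideanSpace ℝ (Fin (d + 1))}
    (he : ‖e‖ = 1) (hf : ‖f‖ = 1) (hef : inner ℝ e f = 0) (a b : ℕ) :
    ∫ x, (inner ℝ e x ^ a * inner ℝ f x ^ b) * Real.exp (-‖x‖ ^ 2 / 2)
      = gaussMoment a * gaussMoment b * gaussMoment 0 ^ (d - 1) := by
  obtain ⟨n, rfl⟩ : ∃ n, d = n + 1 := ⟨d - 1, by omega⟩
  -- Only the values at `0` and `1` matter; the remaining ones are placeholders replaced by the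
  -- extension.
  let v : Fin (n + 1 + 1) → EuclideanSpace ℝ (Fin (n + 1 + 1)) :=
    fun i => if i = 0 then e else f
  have hv : Orthonormal ℝ (({0, 1} : Set (Fin (n + 1 + 1))).domRestrict v) := by
    have hfe : inner ℝ f e = 0 := by rw [real_inner_comm]; exact hef
    constructor
    · rintro ⟨i, rfl | rfl⟩ <;> simp [v, he, hf]
    · rintro ⟨i, rfl | rfl⟩ ⟨j, rfl | rfl⟩ hij <;> simp_all [v]
  obtain ⟨B, hB⟩ := hv.exists_orthonormalBasis_extension_of_card_eq (by simp)
  have hB0 : B 0 = e := by rw [hB 0 (by simp)]; simp [v]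
  have hB1 : B 1 = f := by rw [hB 1 (by simp)]; simp [v]
  have hmp : MeasurePreserving (fun y : Fin (n + 1 + 1) → ℝ => B.repr.symm (WithLp.toLp 2 y)) :=
    B.measurePreserving_repr_symm.comp (PiLp.volume_preserving_toLp _)
  have hme : MeasurableEmbedding (fun y : Fin (n + 1 + 1) → ℝ => B.repr.symm (WithLp.toLp 2 y)) :=
    B.repr.symm.toHomeomorph.measurableEmbedding.comp
      (MeasurableEquiv.toLp 2 _).measurableEmbedding
  rw [← hmp.integral_comp hme]
  let κ : Fin (n + 1 + 1) → ℕ := Fin.cons a (Fin.cons b fun _ => 0)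
  have hint : ∀ y : Fin (n + 1 + 1) → ℝ,
      (inner ℝ e (B.repr.symm (WithLp.toLp 2 y)) ^ a * inner ℝ f (B.repr.symm (WithLp.toLp 2 y)) ^ b)
        * Real.exp (-‖B.repr.symm (WithLp.toLp 2 y)‖ ^ 2 / 2)
      = ∏ i, (y i ^ κ i * Real.exp (-y i ^ 2 / 2)) := by
    intro y
    have h0 : inner ℝ e (B.repr.symm (WithLp.toLp 2 y)) = y 0 := by
      rw [← hB0, ← B.repr_apply_apply]; simp
    have h1 : inner ℝ f (B.repr.symm (WithLp.toLp 2 y)) = y 1 := by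
      rw [← hB1, ← B.repr_apply_apply]; simp
    rw [h0, h1, LinearIsometryEquiv.norm_map, EuclideanSpace.norm_sq_eq, Finset.prod_mul_distrib,
      ← Real.exp_sum]
    congr 1
    · simp [Fin.prod_univ_succ, κ]
    · congr 1
      simp [Finset.sum_div, neg_div]
  simp_rw [hint]
  rw [integral_fintype_prod_volume_eq_prod (fun i (x : ℝ) => x ^ κ i * Real.exp (-x ^ 2 / 2))]
  change ∏ i, gaussMoment (κ i) = _
  simp [Fin.prod_univ_succ, κ, mul_assoc]

/-- Joint moments of two orthogonal coordinates on the sphere. -/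
noncomputable def sphereMoment (d : ℕ) (e f : EuclideanSpace ℝ (Fin (d + 1))) (a b : ℕ) : ℝ :=
  ∫ z : UnitSphere d, inner ℝ e z ^ a * inner ℝ f z ^ b ∂(sphereMeasure d)

section
variable {d : ℕ} {e f : EuclideanSpace ℝ (Fin (d + 1))}

/-- The same Gaussian integral is evaluated in polar and in Cartesian coordinates. The right side
does not depend on the frame, and the radial factor is positive, so moment recursions on the sphere
follow by division. -/
lemma sphereMoment_mul_radialMoment (hd : 1 ≤ d) (he : ‖e‖ = 1) (hf : ‖f‖ = 1)
    (hef : inner ℝ e f = 0) (a b : ℕ) :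
    sphereMoment d e f a b * radialMoment (a + b + d)
      = gaussMoment a * gaussMoment b * gaussMoment 0 ^ (d - 1) := by
  rw [← integral_inner_pow_mul_exp hd he hf hef, sphereMoment,
    ← integral_homogeneous_mul_exp (fun x => inner ℝ e x ^ a * inner ℝ f x ^ b)]
  intro r x _
  rw [real_inner_smul_right, real_inner_smul_right]
  ring

lemma sphereMoment_add_two_left (hd : 1 ≤ d) (he : ‖e‖ = 1) (hf : ‖f‖ = 1)
    (hef : inner ℝ e f = 0) (a b : ℕ) :
    (a + b + d + 1) * sphereMoment d e f (a + 2) b = (a + 1) * sphereMoment d e f a b := by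
  have h1 := sphereMoment_mul_radialMoment hd he hf hef (a + 2) b
  have h2 := sphereMoment_mul_radialMoment hd he hf hef a b
  have h3 := radialMoment_add_two (a + b + d)
  rw [show a + 2 + b + d = a + b + d + 2 by ring, h3, gaussMoment_add_two] at h1
  apply mul_right_cancel₀ (radialMoment_pos (a + b + d)).ne'
  push_cast at h1
  linear_combination h1 - (a + 1 : ℝ) * h2

lemma sphereMoment_add_two_right (hd : 1 ≤ d) (he : ‖e‖ = 1) (hf : ‖f‖ = 1)
    (hef : inner ℝ e f = 0) (a b : ℕ) :
    (a + b + d + 1) * sphereMoment d e f a (b + 2) = (b + 1) * sphereMoment d e f a b := by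
  have h1 := sphereMoment_mul_radialMoment hd he hf hef a (b + 2)
  have h2 := sphereMoment_mul_radialMoment hd he hf hef a b
  have h3 := radialMoment_add_two (a + b + d)
  rw [show a + (b + 2) + d = a + b + d + 2 by ring, h3, gaussMoment_add_two] at h1
  apply mul_right_cancel₀ (radialMoment_pos (a + b + d)).ne'
  push_cast at h1
  linear_combination h1 - (b + 1 : ℝ) * h2

lemma sphereMoment_one_left (hd : 1 ≤ d) (he : ‖e‖ = 1) (hf : ‖f‖ = 1)
    (hef : inner ℝ e f = 0) (b : ℕ) : sphereMoment d e f 1 b = 0 := by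
  have h1 := sphereMoment_mul_radialMoment hd he hf hef 1 b
  rw [gaussMoment_one, zero_mul, zero_mul] at h1
  exact (mul_eq_zero.1 h1).resolve_right (radialMoment_pos _).ne'

lemma sphereMoment_one_right (hd : 1 ≤ d) (he : ‖e‖ = 1) (hf : ‖f‖ = 1)
    (hef : inner ℝ e f = 0) (a : ℕ) : sphereMoment d e f a 1 = 0 := by
  have h1 := sphereMoment_mul_radialMoment hd he hf hef a 1
  rw [gaussMoment_one, mul_zero, zero_mul] at h1
  exact (mul_eq_zero.1 h1).resolve_right (radialMoment_pos _).ne'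

end

/-! ### Integration of zonal polynomials, Green's identity and orthogonality -/

section
open Polynomial

variable {d : ℕ}

lemma integrable_sphere {g : UnitSphere d → ℝ} (hg : Continuous g) :
    Integrable g (sphereMeasure d) :=
  hg.integrable_of_hasCompactSupport (HasCompactSupport.of_compactSpace g)

lemma continuous_eval_inner (q : ℝ[X]) (e : EuclideanSpace ℝ (Fin (d + 1))) :
    Continuous fun z : UnitSphere d => q.eval (inner ℝ e (z : EuclideanSpace ℝ (Fin (d + 1)))) := by
  have : Continuous fun z : UnitSphere d => inner ℝ e (z : EuclideanSpace ℝ (Fin (d + 1))) := by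
    fun_prop
  exact q.continuous.comp this

/-- The integral over `S^d` of a polynomial in one coordinate. -/
noncomputable def zonalIntegral (d : ℕ) : ℝ[X] →ₗ[ℝ] ℝ where
  toFun q := ∫ z : UnitSphere d,
    q.eval (inner ℝ (EuclideanSpace.single 0 1 : EuclideanSpace ℝ (Fin (d + 1))) z)
      ∂(sphereMeasure d)
  map_add' p q := by
    simp only [eval_add]
    exact integral_add (integrable_sphere (continuous_eval_inner p _))
      (integrable_sphere (continuous_eval_inner q _))
  map_smul' c q := by
    simp only [eval_smul, smul_eq_mul, RingHom.id_apply]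
    exact integral_const_mul _ _

lemma exists_unit_orthogonal (hd : 1 ≤ d) (e : EuclideanSpace ℝ (Fin (d + 1))) :
    ∃ f : EuclideanSpace ℝ (Fin (d + 1)), ‖f‖ = 1 ∧ inner ℝ e f = 0 := by
  have h : 0 < Module.finrank ℝ (ℝ ∙ e)ᗮ := by
    have h1 := Submodule.finrank_add_finrank_orthogonal (ℝ ∙ e)
    have h2 : Module.finrank ℝ (ℝ ∙ e) ≤ 1 := by
      simpa using finrank_span_le_card (R := ℝ) ({e} : Set (EuclideanSpace ℝ (Fin (d + 1))))
    rw [finrank_euclideanSpace_fin] at h1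
    omega
  have := Module.nontrivial_of_finrank_pos h
  obtain ⟨v, hv⟩ := exists_ne (0 : (ℝ ∙ e)ᗮ)
  have hv' : (v : EuclideanSpace ℝ (Fin (d + 1))) ≠ 0 := by simpa using hv
  refine ⟨‖(v : EuclideanSpace ℝ (Fin (d + 1)))‖⁻¹ • v, norm_smul_inv_norm hv', ?_⟩
  rw [real_inner_smul_right, Submodule.mem_orthogonal_singleton_iff_inner_right.1 v.2, mul_zero]

/-- Rotation invariance is obtained from moments: each one is a quotient of Gaussian and radial
moments in which `e` no longer appears. -/
lemma integral_eval_inner (hd : 1 ≤ d) {e : EuclideanSpace ℝ (Fin (d + 1))} (he : ‖e‖ = 1)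
    (q : ℝ[X]) :
    ∫ z : UnitSphere d, q.eval (inner ℝ e z) ∂(sphereMeasure d) = zonalIntegral d q := by
  obtain ⟨f, hf, hef⟩ := exists_unit_orthogonal hd e
  obtain ⟨f', hf', hef'⟩ := exists_unit_orthogonal hd
    (EuclideanSpace.single 0 1 : EuclideanSpace ℝ (Fin (d + 1)))
  induction q using Polynomial.induction_on' with
  | add p q hp hq =>
    rw [map_add, ← hp, ← hq]
    simp only [eval_add]
    exact integral_add (integrable_sphere (continuous_eval_inner p _))
      (integrable_sphere (continuous_eval_inner q _))
  | monomial n a =>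
    have h1 := sphereMoment_mul_radialMoment hd he hf hef n 0
    have h2 := sphereMoment_mul_radialMoment hd (by simp) hf' hef' n 0
    have h3 := mul_right_cancel₀ (radialMoment_pos _).ne' (h1.trans h2.symm)
    simp only [sphereMoment, pow_zero, mul_one] at h3
    simp only [zonalIntegral, LinearMap.coe_mk, AddHom.coe_mk, eval_monomial]
    rw [integral_const_mul, integral_const_mul, h3]

lemma sphereMoment_zero_right (hd : 1 ≤ d) {e : EuclideanSpace ℝ (Fin (d + 1))} (he : ‖e‖ = 1)
    (f : EuclideanSpace ℝ (Fin (d + 1))) (a : ℕ) :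
    sphereMoment d e f a 0 = zonalIntegral d (X ^ a) := by
  rw [← integral_eval_inner hd he]
  simp [sphereMoment]

lemma zonalIntegral_C_mul (a : ℝ) (q : ℝ[X]) :
    zonalIntegral d (C a * q) = a * zonalIntegral d q := by
  rw [← smul_eq_C_mul, map_smul, smul_eq_mul]

/-- The integrand is the divergence on the sphere of `w` times the gradient of the height function.
On monomials the claim is exactly the moment recursion. -/
lemma zonalIntegral_divergence (hd : 1 ≤ d) (w : ℝ[X]) :
    zonalIntegral d ((1 - X ^ 2) * derivative w - C (d : ℝ) * X * w) = 0 := by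
  have he : ‖(EuclideanSpace.single 0 1 : EuclideanSpace ℝ (Fin (d + 1)))‖ = 1 := by simp
  obtain ⟨f, hf, hef⟩ := exists_unit_orthogonal hd
    (EuclideanSpace.single 0 1 : EuclideanSpace ℝ (Fin (d + 1)))
  induction w using Polynomial.induction_on' with
  | add p q hp hq =>
    have : (1 - X ^ 2) * derivative (p + q) - C (d : ℝ) * X * (p + q)
        = ((1 - X ^ 2) * derivative p - C (d : ℝ) * X * p)
          + ((1 - X ^ 2) * derivative q - C (d : ℝ) * X * q) := by
      rw [derivative_add]; ring
    rw [this, map_add, hp, hq, add_zero]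
  | monomial n a =>
    cases n with
    | zero =>
      have h := sphereMoment_one_left hd he hf hef 0
      rw [sphereMoment_zero_right hd he] at h
      have : (1 - X ^ 2) * derivative (monomial 0 a) - C (d : ℝ) * X * monomial 0 a
          = C (-d * a) * X ^ 1 := by
        rw [monomial_zero_left]
        simp
        ring
      rw [this, zonalIntegral_C_mul, h, mul_zero]
    | succ k =>
      have h := sphereMoment_add_two_left hd he hf hef k 0
      rw [sphereMoment_zero_right hd he, sphereMoment_zero_right hd he] at h
      have : (1 - X ^ 2) * derivative (monomial (k + 1) a) - C (d : ℝ) * X * monomial (k + 1) a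
          = C ((k + 1) * a) * X ^ k - C ((k + d + 1) * a) * X ^ (k + 2) := by
        rw [derivative_monomial, ← C_mul_X_pow_eq_monomial, ← C_mul_X_pow_eq_monomial]
        simp
        ring
      rw [this, map_sub, zonalIntegral_C_mul, zonalIntegral_C_mul]
      push_cast at h
      linear_combination -a * h

/-- Green's identity: the difference of the integrands is the divergence expression for the
Wronskian `u v' - v u'`. -/
lemma zonalIntegral_mul_zonalLaplacian_comm (hd : 1 ≤ d) (u v : ℝ[X]) :
    zonalIntegral d (u * zonalLaplacian d v) = zonalIntegral d (v * zonalLaplacian d u) := by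
  have h := zonalIntegral_divergence hd (u * derivative v - v * derivative u)
  rw [← sub_eq_zero, ← map_sub, ← h]
  congr 1
  simp only [zonalLaplacian, derivative_sub, derivative_mul]
  ring

lemma laplaceEigenvalue_lt (hd : 1 ≤ d) {k n : ℕ} (h : k < n) :
    laplaceEigenvalue d k < laplaceEigenvalue d n := by
  have h1 : (1 : ℝ) ≤ d := by exact_mod_cast hd
  have h2 : (k : ℝ) + 1 ≤ n := by exact_mod_cast h
  have h3 : (0 : ℝ) ≤ k := Nat.cast_nonneg k
  unfold laplaceEigenvalue
  nlinarith

lemma zonalLaplacian_X_pow (k : ℕ) :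
    zonalLaplacian d (X ^ (k + 2)) = C (-laplaceEigenvalue d (k + 2)) * X ^ (k + 2)
      + C ((k + 2 : ℝ) * (k + 1)) * X ^ k := by
  have h2 : (C 2 : ℝ[X]) = 2 := rfl
  simp only [zonalLaplacian, laplaceEigenvalue]
  simp [h2]
  ring

/-- Symmetry of the Laplacian and distinctness of eigenvalues give orthogonality. The Laplacian
sends `X ^ (k + 2)` to a multiple of itself plus a multiple of `X ^ k`, hence the induction in steps
of two. -/
lemma zonalIntegral_zonalPoly_mul_X_pow (hd : 1 ≤ d) {n : ℕ} (k : ℕ) (hk : k < n) :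
    zonalIntegral d (zonalPoly d n * X ^ k) = 0 := by
  induction k using Nat.twoStepInduction with
  | zero =>
    have h := zonalIntegral_mul_zonalLaplacian_comm hd 1 (zonalPoly d n)
    have h0 : zonalLaplacian d (1 : ℝ[X]) = 0 := by simp [zonalLaplacian]
    rw [h0, mul_zero, map_zero, zonalLaplacian_zonalPoly hd, one_mul, zonalIntegral_C_mul] at h
    rw [pow_zero, mul_one]
    have := laplaceEigenvalue_lt hd hk
    have h1 : laplaceEigenvalue d 0 = 0 := by simp [laplaceEigenvalue]
    exact (mul_eq_zero.1 h).resolve_left (by linarith)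
  | one =>
    have h := zonalIntegral_mul_zonalLaplacian_comm hd X (zonalPoly d n)
    have h0 : zonalLaplacian d (X : ℝ[X]) = C (-(d : ℝ)) * X := by simp [zonalLaplacian]
    rw [h0, zonalLaplacian_zonalPoly hd, mul_left_comm, zonalIntegral_C_mul, mul_left_comm,
      zonalIntegral_C_mul, mul_comm X] at h
    have := laplaceEigenvalue_lt hd hk
    have h1 : laplaceEigenvalue d 1 = d := by simp [laplaceEigenvalue]
    rw [pow_one]
    have h2 : (laplaceEigenvalue d n - d) * zonalIntegral d (zonalPoly d n * X) = 0 := by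
      linarith
    exact (mul_eq_zero.1 h2).resolve_left (by linarith)
  | more k h0 _ =>
    have h := zonalIntegral_mul_zonalLaplacian_comm hd (X ^ (k + 2)) (zonalPoly d n)
    rw [zonalLaplacian_X_pow, zonalLaplacian_zonalPoly hd, mul_left_comm, zonalIntegral_C_mul,
      mul_add, map_add, mul_left_comm, zonalIntegral_C_mul, mul_left_comm, zonalIntegral_C_mul,
      h0 (by omega), mul_comm (X ^ (k + 2))] at h
    have := laplaceEigenvalue_lt hd hk
    have h2 : (laplaceEigenvalue d n - laplaceEigenvalue d (k + 2))
        * zonalIntegral d (zonalPoly d n * X ^ (k + 2)) = 0 := by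
      linarith
    exact (mul_eq_zero.1 h2).resolve_left (by linarith)

lemma zonalIntegral_zonalPoly_mul (hd : 1 ≤ d) {n : ℕ} {q : ℝ[X]} (hq : q.natDegree < n) :
    zonalIntegral d (zonalPoly d n * q) = 0 := by
  rw [q.as_sum_range' n hq, Finset.mul_sum, map_sum]
  refine Finset.sum_eq_zero fun k hk => ?_
  rw [← C_mul_X_pow_eq_monomial, mul_left_comm, zonalIntegral_C_mul,
    zonalIntegral_zonalPoly_mul_X_pow hd k (Finset.mem_range.1 hk), mul_zero]

/-! ### Averages over parallels, the product formula and Schur products -/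

/-- The ratios of the moments of a coordinate of the sphere `S^{d-1}`. -/
noncomputable def transverseMoment (d : ℕ) : ℕ → ℝ
  | 0 => 1
  | 1 => 0
  | m + 2 => transverseMoment d m * (m + 1) / (m + d)

lemma transverseMoment_odd (j : ℕ) : transverseMoment d (2 * j + 1) = 0 := by
  induction j with
  | zero => rfl
  | succ j ih =>
    rw [show 2 * (j + 1) + 1 = 2 * j + 1 + 2 by ring, transverseMoment, ih]
    simp

/-- This is the divergence identity for `X ^ (a + 1) * (1 - X ^ 2) ^ j`. -/
lemma zonalIntegral_X_pow_mul_pow_succ (hd : 1 ≤ d) (a j : ℕ) :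
    (a + 2 * j + d + 1) * zonalIntegral d (X ^ a * (1 - X ^ 2) ^ (j + 1))
      = (2 * j + d) * zonalIntegral d (X ^ a * (1 - X ^ 2) ^ j) := by
  have h := zonalIntegral_divergence hd (X ^ (a + 1) * (1 - X ^ 2) ^ j)
  have h2 : (1 - X ^ 2) * derivative (X ^ (a + 1) * (1 - X ^ 2) ^ j)
      - C (d : ℝ) * X * (X ^ (a + 1) * (1 - X ^ 2) ^ j)
      = C (a + 2 * j + d + 1 : ℝ) * (X ^ a * (1 - X ^ 2) ^ (j + 1))
        - C (2 * j + d : ℝ) * (X ^ a * (1 - X ^ 2) ^ j) := by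
    cases j with
    | zero => simp; ring
    | succ j => simp [derivative_pow]; ring
  rw [h2, map_sub, zonalIntegral_C_mul, zonalIntegral_C_mul] at h
  linarith

/-- At height `z₀` the second coordinate is `√(1 - z₀²)` times a coordinate of the lower sphere.
Both sides obey the same two-step recursion in `m`; rounding in `m / 2` is harmless because odd
moments vanish. -/
lemma sphereMoment_eq (hd : 1 ≤ d) {e f : EuclideanSpace ℝ (Fin (d + 1))}
    (he : ‖e‖ = 1) (hf : ‖f‖ = 1) (hef : inner ℝ e f = 0) (a m : ℕ) :
    sphereMoment d e f a m
      = transverseMoment d m * zonalIntegral d (X ^ a * (1 - X ^ 2) ^ (m / 2)) := by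
  induction m using Nat.twoStepInduction with
  | zero => rw [sphereMoment_zero_right hd he]; simp [transverseMoment]
  | one => rw [sphereMoment_one_right hd he hf hef]; simp [transverseMoment]
  | more m h0 _ =>
    have h1 := sphereMoment_add_two_right hd he hf hef a m
    have h3 : (a + m + d + 1 : ℝ) ≠ 0 := by positivity
    have h4 : (m + d : ℝ) ≠ 0 := by positivity
    apply mul_left_cancel₀ h3
    rw [h1, h0, transverseMoment]
    rcases Nat.even_or_odd' m with ⟨j, rfl | rfl⟩
    · have h2 := zonalIntegral_X_pow_mul_pow_succ hd a j
      rw [show 2 * j / 2 = j by omega, show (2 * j + 2) / 2 = j + 1 by omega]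
      push_cast at h4 ⊢
      field_simp
      linear_combination (-1 : ℝ) * transverseMoment d (2 * j) * h2
    · rw [transverseMoment_odd]; simp

/-- The conditional expectation of `(c z₀ + s z₁)^k` given `z₀`, where `c² + s² = 1`. -/
noncomputable def transversePoly (d k : ℕ) (c : ℝ) : ℝ[X] :=
  ∑ m ∈ Finset.range (k + 1),
    C (k.choose m * transverseMoment d m * c ^ (k - m) * (1 - c ^ 2) ^ (m / 2))
      * (X ^ (k - m) * (1 - X ^ 2) ^ (m / 2))

lemma transversePoly_eval_one (k : ℕ) (c : ℝ) : (transversePoly d k c).eval 1 = c ^ k := by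
  rw [transversePoly, eval_finsetSum, Finset.sum_eq_single 0]
  · simp [transverseMoment]
  · intro m _ hm
    rcases Nat.lt_or_ge m 2 with h | h
    · obtain rfl : m = 1 := by omega
      simp [transverseMoment]
    · have : m / 2 ≠ 0 := by omega
      simp [this]
  · simp

lemma transversePoly_natDegree_le (k : ℕ) (c : ℝ) : (transversePoly d k c).natDegree ≤ k := by
  refine natDegree_sum_le_of_forall_le _ _ fun m hm => ?_
  refine (natDegree_C_mul_le _ _).trans (natDegree_mul_le.trans ?_)
  have h1 : (1 - X ^ 2 : ℝ[X]).natDegree ≤ 2 := by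
    refine (natDegree_sub_le _ _).trans ?_
    simp
  have h2 : ((1 - X ^ 2 : ℝ[X]) ^ (m / 2)).natDegree ≤ m / 2 * 2 :=
    natDegree_pow_le.trans (by gcongr)
  rw [natDegree_X_pow]
  have := Finset.mem_range.1 hm
  omega

/-- Expanding the power binomially and integrating each mixed moment gives the claim; odd powers of
`s` drop out and even ones are powers of `1 - c²`, so the answer depends on `c` alone. -/
lemma integral_inner_pow_mul_eval (hd : 1 ≤ d) {e f : EuclideanSpace ℝ (Fin (d + 1))}
    (he : ‖e‖ = 1) (hf : ‖f‖ = 1) (hef : inner ℝ e f = 0) {c s : ℝ} (hcs : c ^ 2 + s ^ 2 = 1)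
    (k : ℕ) (q : ℝ[X]) :
    ∫ z : UnitSphere d, inner ℝ (c • e + s • f) (z : EuclideanSpace ℝ (Fin (d + 1))) ^ k
        * q.eval (inner ℝ e z) ∂(sphereMeasure d)
      = zonalIntegral d (transversePoly d k c * q) := by
  have hc1 : ∀ v : EuclideanSpace ℝ (Fin (d + 1)), Continuous fun z : UnitSphere d =>
      inner ℝ v (z : EuclideanSpace ℝ (Fin (d + 1))) := fun v => by fun_prop
  induction q using Polynomial.induction_on' with
  | add p q hp hq =>
    rw [mul_add, map_add, ← hp, ← hq, ← integral_add]
    · simp only [eval_add, mul_add]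
    · exact integrable_sphere (((hc1 _).pow k).mul (continuous_eval_inner p _))
    · exact integrable_sphere (((hc1 _).pow k).mul (continuous_eval_inner q _))
  | monomial n a =>
    have h1 : ∀ z : UnitSphere d,
        inner ℝ (c • e + s • f) (z : EuclideanSpace ℝ (Fin (d + 1))) ^ k
          * (monomial n a).eval (inner ℝ e (z : EuclideanSpace ℝ (Fin (d + 1))))
        = ∑ m ∈ Finset.range (k + 1), (a * k.choose m * c ^ (k - m) * s ^ m) *
          (inner ℝ e (z : EuclideanSpace ℝ (Fin (d + 1))) ^ (n + (k - m))
            * inner ℝ f (z : EuclideanSpace ℝ (Fin (d + 1))) ^ m) := by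
      intro z
      rw [inner_add_left, real_inner_smul_left, real_inner_smul_left, eval_monomial,
        add_comm (c * _), add_pow, Finset.sum_mul]
      refine Finset.sum_congr rfl fun m _ => ?_
      rw [mul_pow, mul_pow, pow_add]
      ring
    simp_rw [h1]
    have h2 : ∀ m, Integrable (fun z : UnitSphere d => (a * k.choose m * c ^ (k - m) * s ^ m) *
          (inner ℝ e (z : EuclideanSpace ℝ (Fin (d + 1))) ^ (n + (k - m))
            * inner ℝ f (z : EuclideanSpace ℝ (Fin (d + 1))) ^ m)) (sphereMeasure d) := fun m =>
      integrable_sphere (continuous_const.mul (((hc1 e).pow _).mul ((hc1 f).pow _)))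
    rw [integral_finsetSum _ fun m _ => h2 m]
    rw [transversePoly, Finset.sum_mul, map_sum]
    refine Finset.sum_congr rfl fun m _ => ?_
    rw [integral_const_mul]
    change _ * sphereMoment d e f (n + (k - m)) m = _
    rw [sphereMoment_eq hd he hf hef, ← C_mul_X_pow_eq_monomial, mul_assoc (C _),
      zonalIntegral_C_mul, mul_left_comm _ (C a), zonalIntegral_C_mul]
    rw [show X ^ (k - m) * (1 - X ^ 2) ^ (m / 2) * X ^ n
      = (X ^ (n + (k - m)) * (1 - X ^ 2) ^ (m / 2) : ℝ[X]) by rw [pow_add]; ring]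
    rcases Nat.even_or_odd' m with ⟨j, rfl | rfl⟩
    · rw [show 2 * j / 2 = j by omega, pow_mul s, show s ^ 2 = 1 - c ^ 2 by linarith]
      ring
    · rw [transverseMoment_odd]; simp

end

section
open Polynomial

variable {d : ℕ}

lemma norm_smul_add_smul_eq_one {e f : EuclideanSpace ℝ (Fin (d + 1))} (he : ‖e‖ = 1)
    (hf : ‖f‖ = 1) (hef : inner ℝ e f = 0) {a b : ℝ} (hab : a ^ 2 + b ^ 2 = 1) :
    ‖a • e + b • f‖ = 1 := by
  have h : ‖a • e + b • f‖ ^ 2 = 1 := by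
    rw [norm_add_sq_real, real_inner_smul_left, real_inner_smul_right, hef, norm_smul, norm_smul,
      he, hf, mul_one, mul_one, Real.norm_eq_abs, Real.norm_eq_abs, sq_abs, sq_abs]
    linarith
  exact (pow_eq_one_iff_of_nonneg (norm_nonneg _) two_ne_zero).1 h

/-- The conditional expectation of `p_n (c z₀ + s z₁)` given `z₀`, where `c² + s² = 1`. -/
noncomputable def transverseZonalPoly (d n : ℕ) (c : ℝ) : ℝ[X] :=
  ∑ k ∈ Finset.range (n + 1), C ((zonalPoly d n).coeff k) * transversePoly d k c

lemma zonalPoly_eval_eq_sum (n : ℕ) (x : ℝ) :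
    (zonalPoly d n).eval x = ∑ k ∈ Finset.range (n + 1), (zonalPoly d n).coeff k * x ^ k :=
  eval_eq_sum_range' (Nat.lt_succ_of_le (zonalPoly_natDegree_le n)) x

lemma transverseZonalPoly_eval_one (n : ℕ) (c : ℝ) :
    (transverseZonalPoly d n c).eval 1 = (zonalPoly d n).eval c := by
  rw [transverseZonalPoly, eval_finsetSum, zonalPoly_eval_eq_sum]
  simp [transversePoly_eval_one]

lemma transverseZonalPoly_natDegree_le (n : ℕ) (c : ℝ) :
    (transverseZonalPoly d n c).natDegree ≤ n := by
  refine natDegree_sum_le_of_forall_le _ _ fun k hk => ?_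
  refine (natDegree_C_mul_le _ _).trans ((transversePoly_natDegree_le k c).trans ?_)
  have := Finset.mem_range.1 hk
  omega

lemma integral_zonalPoly_mul_eval (hd : 1 ≤ d) {e f : EuclideanSpace ℝ (Fin (d + 1))}
    (he : ‖e‖ = 1) (hf : ‖f‖ = 1) (hef : inner ℝ e f = 0) {c s : ℝ} (hcs : c ^ 2 + s ^ 2 = 1)
    (n : ℕ) (q : ℝ[X]) :
    ∫ z : UnitSphere d, (zonalPoly d n).eval
        (inner ℝ (c • e + s • f) (z : EuclideanSpace ℝ (Fin (d + 1))))
        * q.eval (inner ℝ e z) ∂(sphereMeasure d)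
      = zonalIntegral d (transverseZonalPoly d n c * q) := by
  have hc1 : Continuous fun z : UnitSphere d =>
      inner ℝ (c • e + s • f) (z : EuclideanSpace ℝ (Fin (d + 1))) := by fun_prop
  have hint : ∀ k, Integrable (fun z : UnitSphere d => (zonalPoly d n).coeff k *
      (inner ℝ (c • e + s • f) (z : EuclideanSpace ℝ (Fin (d + 1))) ^ k
        * q.eval (inner ℝ e (z : EuclideanSpace ℝ (Fin (d + 1)))))) (sphereMeasure d) := fun k =>
    integrable_sphere (continuous_const.mul ((hc1.pow k).mul (continuous_eval_inner q e)))
  simp_rw [zonalPoly_eval_eq_sum, Finset.sum_mul, mul_assoc]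
  rw [integral_finsetSum _ fun k _ => hint k, transverseZonalPoly, Finset.sum_mul, map_sum]
  refine Finset.sum_congr rfl fun k _ => ?_
  rw [integral_const_mul, integral_inner_pow_mul_eval hd he hf hef hcs, mul_assoc,
    zonalIntegral_C_mul]

/-- Averaging commutes with the inner product: the integral equals that of `p_n (y'z) q (e'z)`, and
conditioning on `y'z` instead replaces `q` by a polynomial of the same degree bound, orthogonal to
`p_n`. -/
lemma zonalIntegral_transverseZonalPoly_mul (hd : 1 ≤ d) {c : ℝ} (hc : c ∈ Set.Icc (-1 : ℝ) 1)
    {n : ℕ} {q : ℝ[X]} (hq : q.natDegree < n) :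
    zonalIntegral d (transverseZonalPoly d n c * q) = 0 := by
  have he : ‖(EuclideanSpace.single 0 1 : EuclideanSpace ℝ (Fin (d + 1)))‖ = 1 := by simp
  set e : EuclideanSpace ℝ (Fin (d + 1)) := EuclideanSpace.single 0 1
  obtain ⟨f, hf, hef⟩ := exists_unit_orthogonal hd e
  obtain ⟨s, hs⟩ : ∃ s : ℝ, c ^ 2 + s ^ 2 = 1 := by
    refine ⟨√(1 - c ^ 2), ?_⟩
    rw [Real.sq_sqrt (by nlinarith [hc.1, hc.2])]
    ring
  have hfe : inner ℝ f e = 0 := by rw [real_inner_comm]; exact hef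
  have hee : inner ℝ e e = (1 : ℝ) := by rw [real_inner_self_eq_norm_sq, he]; norm_num
  have hff : inner ℝ f f = (1 : ℝ) := by rw [real_inner_self_eq_norm_sq, hf]; norm_num
  set y := c • e + s • f with hy
  -- The frame is turned so that `e = c y + s g`, with the same `c, s`; the previous formula then
  -- applies with `y` as the pole.
  set g := s • e + (-c) • f with hg
  have hy1 : ‖y‖ = 1 := norm_smul_add_smul_eq_one he hf hef hs
  have hg1 : ‖g‖ = 1 := norm_smul_add_smul_eq_one he hf hef (by linarith)
  have hyg : inner ℝ y g = 0 := by
    simp only [hy, hg, inner_add_left, inner_add_right, real_inner_smul_left,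
      real_inner_smul_right, hee, hff, hef, hfe]
    ring
  have hey : e = c • y + s • g := by
    have h1 : c • y + s • g = (c ^ 2 + s ^ 2) • e := by rw [hy, hg]; module
    rw [h1, hs, one_smul]
  rw [← integral_zonalPoly_mul_eval hd he hf hef hs n q, ← hy]
  rw [q.as_sum_range' n hq]
  simp only [eval_finsetSum, Finset.mul_sum, eval_monomial]
  have hint : ∀ k, Integrable (fun z : UnitSphere d =>
      (zonalPoly d n).eval (inner ℝ y (z : EuclideanSpace ℝ (Fin (d + 1)))) * (q.coeff k *
        inner ℝ e (z : EuclideanSpace ℝ (Fin (d + 1))) ^ k)) (sphereMeasure d) := fun k => by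
    have hc1 : Continuous fun z : UnitSphere d =>
      inner ℝ e (z : EuclideanSpace ℝ (Fin (d + 1))) := by fun_prop
    exact integrable_sphere ((continuous_eval_inner _ y).mul (continuous_const.mul (hc1.pow k)))
  rw [integral_finsetSum _ fun k _ => hint k]
  refine Finset.sum_eq_zero fun k hk => ?_
  have h2 := integral_inner_pow_mul_eval hd hy1 hg1 hyg hs k (zonalPoly d n)
  rw [← hey, mul_comm (transversePoly d k c), zonalIntegral_zonalPoly_mul hd
    ((transversePoly_natDegree_le k c).trans_lt (Finset.mem_range.1 hk))] at h2
  rw [← mul_zero (q.coeff k), ← h2, ← integral_const_mul]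
  refine integral_congr_ae (ae_of_all _ fun z => ?_)
  simp only
  ring

lemma exists_inner_eq (hd : 1 ≤ d) (x : UnitSphere d) {c : ℝ} (hc : c ∈ Set.Icc (-1 : ℝ) 1) :
    ∃ y : UnitSphere d, inner ℝ (x : EuclideanSpace ℝ (Fin (d + 1))) y = c := by
  have hx : ‖(x : EuclideanSpace ℝ (Fin (d + 1)))‖ = 1 := norm_eq_of_mem_sphere x
  obtain ⟨f, hf, hef⟩ := exists_unit_orthogonal hd (x : EuclideanSpace ℝ (Fin (d + 1)))
  have hs : √(1 - c ^ 2) ^ 2 = 1 - c ^ 2 := Real.sq_sqrt (by nlinarith [hc.1, hc.2])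
  refine ⟨⟨c • (x : EuclideanSpace ℝ (Fin (d + 1))) + √(1 - c ^ 2) • f, ?_⟩, ?_⟩
  · rw [mem_sphere_zero_iff_norm]
    exact norm_smul_add_smul_eq_one hx hf hef (by linarith)
  · simp only [inner_add_right, real_inner_smul_right, hef, real_inner_self_eq_norm_sq, hx]
    ring

/-- The pole of the sphere. -/
noncomputable def northPole (d : ℕ) : UnitSphere d :=
  ⟨EuclideanSpace.single 0 1, by simp⟩

lemma zonalIntegral_mul_self_nonneg (q : ℝ[X]) : 0 ≤ zonalIntegral d (q * q) := by
  refine integral_nonneg fun z => ?_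
  rw [eval_mul]
  exact mul_self_nonneg _

/-- A continuous nonnegative function with zero integral vanishes because the surface measure
charges open sets; heights fill `[-1, 1]`, so `q` has infinitely many roots. -/
lemma zonalIntegral_mul_self_eq_zero (hd : 1 ≤ d) {q : ℝ[X]} (hq : zonalIntegral d (q * q) = 0) :
    q = 0 := by
  have hcont := continuous_eval_inner (d := d) (q * q) (EuclideanSpace.single 0 1)
  have h1 := (integral_eq_zero_iff_of_nonneg (μ := sphereMeasure d) (fun z => by
    rw [eval_mul]; exact mul_self_nonneg _) (integrable_sphere hcont)).1 hq
  have h2 := (hcont.ae_eq_iff_eq (sphereMeasure d) continuous_zero).1 h1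
  refine eq_zero_of_infinite_isRoot q (Set.Infinite.mono (s := Set.Icc (-1 : ℝ) 1) ?_
    (Set.Icc_infinite (by norm_num)))
  intro c hc
  obtain ⟨y, hy⟩ := exists_inner_eq hd (northPole d) hc
  have h3 := congrFun h2 y
  simp only [eval_mul, Pi.zero_apply] at h3
  have h4 : inner ℝ (EuclideanSpace.single 0 1 : EuclideanSpace ℝ (Fin (d + 1))) y = c := hy
  rw [h4] at h3
  exact mul_self_eq_zero.1 h3

/-- The squared norm of the zonal polynomial on the sphere. -/
noncomputable def zonalNorm (d n : ℕ) : ℝ := zonalIntegral d (zonalPoly d n * zonalPoly d n)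

lemma zonalNorm_pos (hd : 1 ≤ d) (n : ℕ) : 0 < zonalNorm d n := by
  refine lt_of_le_of_ne (zonalIntegral_mul_self_nonneg _) fun h => ?_
  have := zonalIntegral_mul_self_eq_zero hd h.symm
  have h1 := zonalPoly_eval_one hd n
  rw [this] at h1
  simp at h1

/-- The product formula for zonal polynomials. -/
lemma transverseZonalPoly_eq (hd : 1 ≤ d) {c : ℝ} (hc : c ∈ Set.Icc (-1 : ℝ) 1) (n : ℕ) :
    transverseZonalPoly d n c = C ((zonalPoly d n).eval c) * zonalPoly d n := by
  set a : ℝ := (transverseZonalPoly d n c).coeff n / (zonalPoly d n).coeff n with ha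
  set r : ℝ[X] := transverseZonalPoly d n c - C a * zonalPoly d n with hr
  have hcoef : r.coeff n = 0 := by
    rw [hr, coeff_sub, coeff_C_mul, ha, div_mul_cancel₀ _ (zonalPoly_coeff_pos hd n).ne', sub_self]
  have hdeg : r.natDegree ≤ n :=
    (natDegree_sub_le _ _).trans (max_le (transverseZonalPoly_natDegree_le n c)
      ((natDegree_C_mul_le _ _).trans (zonalPoly_natDegree_le n)))
  -- The constant `a` kills the coefficient of degree `n`. Either the degree is smaller and `r` is
  -- orthogonal to itself, or the leading coefficient is zero.
  have hr0 : r = 0 := by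
    rcases hdeg.lt_or_eq with h | h
    · refine zonalIntegral_mul_self_eq_zero hd ?_
      nth_rw 1 [hr]
      rw [sub_mul, map_sub, zonalIntegral_transverseZonalPoly_mul hd hc h, mul_assoc,
        zonalIntegral_C_mul, zonalIntegral_zonalPoly_mul hd h]
      simp
    · rw [← leadingCoeff_eq_zero, leadingCoeff, h]
      exact hcoef
  have h1 : transverseZonalPoly d n c = C a * zonalPoly d n := sub_eq_zero.1 hr0
  have h2 := congrArg (eval 1) h1
  rw [transverseZonalPoly_eval_one, eval_mul, eval_C, zonalPoly_eval_one hd, mul_one] at h2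
  rw [h1, h2]

lemma inner_mem_Icc (x y : UnitSphere d) :
    inner ℝ (x : EuclideanSpace ℝ (Fin (d + 1))) y ∈ Set.Icc (-1 : ℝ) 1 := by
  have h := abs_real_inner_le_norm (x : EuclideanSpace ℝ (Fin (d + 1))) y
  rw [norm_eq_of_mem_sphere x, norm_eq_of_mem_sphere y, one_mul] at h
  exact abs_le.1 h

/-- The reproducing property of zonal polynomials. -/
lemma integral_zonalPoly_mul_zonalPoly (hd : 1 ≤ d) (n : ℕ) (x y : UnitSphere d) :
    ∫ z : UnitSphere d, (zonalPoly d n).eval (inner ℝ (x : EuclideanSpace ℝ (Fin (d + 1))) z)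
        * (zonalPoly d n).eval (inner ℝ (y : EuclideanSpace ℝ (Fin (d + 1))) z) ∂(sphereMeasure d)
      = zonalNorm d n * (zonalPoly d n).eval (inner ℝ (x : EuclideanSpace ℝ (Fin (d + 1))) y) := by
  have hx : ‖(x : EuclideanSpace ℝ (Fin (d + 1)))‖ = 1 := norm_eq_of_mem_sphere x
  have hy : ‖(y : EuclideanSpace ℝ (Fin (d + 1)))‖ = 1 := norm_eq_of_mem_sphere y
  set c : ℝ := inner ℝ (x : EuclideanSpace ℝ (Fin (d + 1))) y with hc
  have hcI : c ∈ Set.Icc (-1 : ℝ) 1 := inner_mem_Icc x y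
  obtain ⟨f, s, hf, hyf, hcs, hxe⟩ : ∃ (f : EuclideanSpace ℝ (Fin (d + 1))) (s : ℝ), ‖f‖ = 1 ∧
      inner ℝ (y : EuclideanSpace ℝ (Fin (d + 1))) f = 0 ∧ c ^ 2 + s ^ 2 = 1 ∧
      (x : EuclideanSpace ℝ (Fin (d + 1))) = c • (y : EuclideanSpace ℝ (Fin (d + 1))) + s • f := by
    set v : EuclideanSpace ℝ (Fin (d + 1)) := x - c • (y : EuclideanSpace ℝ (Fin (d + 1))) with hv
    have hyv : inner ℝ (y : EuclideanSpace ℝ (Fin (d + 1))) v = 0 := by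
      rw [hv, inner_sub_right, real_inner_smul_right, real_inner_self_eq_norm_sq, hy,
        real_inner_comm, ← hc]
      ring
    have hvn : ‖v‖ ^ 2 = 1 - c ^ 2 := by
      rw [hv, norm_sub_sq_real, real_inner_smul_right, ← hc, norm_smul, hx, hy, mul_one,
        Real.norm_eq_abs, sq_abs]
      ring
    by_cases h0 : v = 0
    · obtain ⟨f, hf, hyf⟩ := exists_unit_orthogonal hd (y : EuclideanSpace ℝ (Fin (d + 1)))
      refine ⟨f, 0, hf, hyf, ?_, ?_⟩
      · rw [h0, norm_zero] at hvn; linarith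
      · rw [zero_smul, add_zero]; exact sub_eq_zero.1 h0
    · refine ⟨‖v‖⁻¹ • v, ‖v‖, norm_smul_inv_norm h0, ?_, by linarith, ?_⟩
      · rw [real_inner_smul_right, hyv, mul_zero]
      · rw [smul_smul, mul_inv_cancel₀ (norm_ne_zero_iff.2 h0), one_smul, hv]
        abel
  rw [hxe, integral_zonalPoly_mul_eval hd hy hf hyf hcs, transverseZonalPoly_eq hd hcI, mul_assoc,
    zonalIntegral_C_mul, mul_comm]
  rfl

/-- The Schur product of a positive definite kernel with a zonal kernel. -/
lemma sum_mul_zonalPoly_nonneg (hd : 1 ≤ d) {ι : Type} {K : ι → ι → ℝ} (x : ι → UnitSphere d)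
    (s : Finset ι) (hK : ∀ w : ι → ℝ, 0 ≤ ∑ i ∈ s, ∑ j ∈ s, w i * w j * K i j)
    (n : ℕ) (w : ι → ℝ) :
    0 ≤ ∑ i ∈ s, ∑ j ∈ s, w i * w j *
      (K i j * (zonalPoly d n).eval (inner ℝ (x i : EuclideanSpace ℝ (Fin (d + 1))) (x j))) := by
  have hκ := zonalNorm_pos hd n
  -- The reproducing property writes the zonal factor as an integral of products, which for each `z`
  -- are absorbed into the weights `w`.
  have key : zonalNorm d n * ∑ i ∈ s, ∑ j ∈ s, w i * w j *
      (K i j * (zonalPoly d n).eval (inner ℝ (x i : EuclideanSpace ℝ (Fin (d + 1))) (x j)))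
      = ∫ z : UnitSphere d, ∑ i ∈ s, ∑ j ∈ s,
        (w i * (zonalPoly d n).eval (inner ℝ (x i : EuclideanSpace ℝ (Fin (d + 1))) z)) *
        (w j * (zonalPoly d n).eval (inner ℝ (x j : EuclideanSpace ℝ (Fin (d + 1))) z)) * K i j
        ∂(sphereMeasure d) := by
    have hint : ∀ i j, Integrable (fun z : UnitSphere d =>
        (w i * (zonalPoly d n).eval (inner ℝ (x i : EuclideanSpace ℝ (Fin (d + 1))) z)) *
        (w j * (zonalPoly d n).eval (inner ℝ (x j : EuclideanSpace ℝ (Fin (d + 1))) z)) * K i j)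
        (sphereMeasure d) := fun i j => integrable_sphere
      (((continuous_const.mul (continuous_eval_inner _ _)).mul
        (continuous_const.mul (continuous_eval_inner _ _))).mul continuous_const)
    rw [integral_finsetSum _ fun i _ => integrable_finsetSum _ fun j _ => hint i j,
      Finset.mul_sum]
    refine Finset.sum_congr rfl fun i _ => ?_
    rw [integral_finsetSum _ fun j _ => hint i j, Finset.mul_sum]
    refine Finset.sum_congr rfl fun j _ => ?_
    have h1 := integral_zonalPoly_mul_zonalPoly hd n (x i) (x j)
    have h2 : zonalNorm d n * (w i * w j * (K i j *
        (zonalPoly d n).eval (inner ℝ (x i : EuclideanSpace ℝ (Fin (d + 1))) (x j))))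
        = (w i * w j * K i j) * (zonalNorm d n *
          (zonalPoly d n).eval (inner ℝ (x i : EuclideanSpace ℝ (Fin (d + 1))) (x j))) := by ring
    rw [h2, ← h1, ← integral_const_mul]
    refine integral_congr_ae (ae_of_all _ fun z => ?_)
    simp only
    ring
  have h3 : 0 ≤ zonalNorm d n * ∑ i ∈ s, ∑ j ∈ s, w i * w j *
      (K i j * (zonalPoly d n).eval (inner ℝ (x i : EuclideanSpace ℝ (Fin (d + 1))) (x j))) := by
    rw [key]
    exact integral_nonneg fun z => hK _
  exact nonneg_of_mul_nonneg_right h3 hκ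

/-- The zonal kernel is positive definite with diagonal `1`; the bound is its quadratic form on two
points with weights `(1, 1)` and `(1, -1)`. -/
lemma abs_zonalPoly_eval_le_one (hd : 1 ≤ d) (n : ℕ) {c : ℝ} (hc : c ∈ Set.Icc (-1 : ℝ) 1) :
    |(zonalPoly d n).eval c| ≤ 1 := by
  obtain ⟨y, hy⟩ := exists_inner_eq hd (northPole d) hc
  have h : ∀ a b : ℝ, 0 ≤ a * a + a * b * (zonalPoly d n).eval c
      + (b * a * (zonalPoly d n).eval c + b * b) := by
    intro a b
    have := sum_mul_zonalPoly_nonneg hd (K := fun _ _ => 1)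
      (fun i : Fin 2 => if i = 0 then northPole d else y) Finset.univ (fun w => by
        rw [Fin.sum_univ_two, Fin.sum_univ_two, Fin.sum_univ_two]
        nlinarith [sq_nonneg (w 0 + w 1)]) n (fun i => if i = 0 then a else b)
    have hy' : inner ℝ (y : EuclideanSpace ℝ (Fin (d + 1))) (northPole d) = c := by
      rw [real_inner_comm]; exact hy
    have hself : ∀ z : UnitSphere d, inner ℝ (z : EuclideanSpace ℝ (Fin (d + 1))) z = (1 : ℝ) := by
      intro z
      rw [real_inner_self_eq_norm_sq, norm_eq_of_mem_sphere]; norm_num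
    simpa only [Fin.sum_univ_two, if_true, one_ne_zero, if_false, one_mul, hself, hy, hy',
      zonalPoly_eval_one hd, mul_one] using this
  rw [abs_le]
  constructor <;> [have := h 1 1; have := h 1 (-1)] <;> linarith

end

/-! ### Resolvent summation and the maximum principle for pointwise convergent series -/

/-- Abel summation: a regular summation method given by monotone factors. -/
lemma tendsto_tsum_mul_of_antitone {c : ℕ → ℝ} {S : ℝ}
    (hc : Tendsto (fun N => ∑ n ∈ Finset.range N, c n) atTop (𝓝 S)) {φ : ℕ → ℕ → ℝ}
    (hanti : ∀ s, Antitone (φ s)) (hpos : ∀ s n, 0 ≤ φ s n) (hle : ∀ s n, φ s n ≤ 1)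
    (hlim : ∀ n, Tendsto (fun s => φ s n) atTop (𝓝 1))
    (hsum : ∀ s, Summable fun n => c n * φ s n) :
    Tendsto (fun s => ∑' n, c n * φ s n) atTop (𝓝 S) := by
  rw [Metric.tendsto_atTop]
  intro ε' hε'
  -- The final error is `2ε` for the damped tail, `ε` for the damping of the first `K` terms and `ε`
  -- for the undamped tail.
  obtain ⟨ε, hε, hεε⟩ : ∃ ε : ℝ, 0 < ε ∧ 4 * ε < ε' := ⟨ε' / 5, by positivity, by linarith⟩
  obtain ⟨K, hK⟩ := Metric.tendsto_atTop.1 hc ε hε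
  have hD : ∀ N, K ≤ N → |∑ n ∈ Finset.range N, c n - S| ≤ ε := fun N hN => (hK N hN).le
  have htail : ∀ s, |∑' n, c n * φ s n - ∑ n ∈ Finset.range K, c n * φ s n| ≤ 2 * ε := by
    intro s
    -- Summation by parts as an induction: the bound is `ε φ_K` from the initial term plus the
    -- telescoped `ε (φ_K - φ_N)`.
    have hind : ∀ N, K ≤ N → |∑ n ∈ Finset.range N, c n * φ s n
        - ∑ n ∈ Finset.range K, c n * φ s n
        - (∑ n ∈ Finset.range N, c n - S) * φ s N| ≤ ε * (2 * φ s K - φ s N) := by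
      intro N hN
      induction N, hN using Nat.le_induction with
      | base =>
        rw [sub_self, zero_sub, abs_neg, abs_mul, abs_of_nonneg (hpos s K)]
        have := mul_le_mul_of_nonneg_right (hD K le_rfl) (hpos s K)
        linarith
      | succ N hN ih =>
        have h1 : ∑ n ∈ Finset.range (N + 1), c n * φ s n - ∑ n ∈ Finset.range K, c n * φ s n
            - (∑ n ∈ Finset.range (N + 1), c n - S) * φ s (N + 1)
            = (∑ n ∈ Finset.range N, c n * φ s n - ∑ n ∈ Finset.range K, c n * φ s n
              - (∑ n ∈ Finset.range N, c n - S) * φ s N)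
              + (∑ n ∈ Finset.range (N + 1), c n - S) * (φ s N - φ s (N + 1)) := by
          rw [Finset.sum_range_succ, Finset.sum_range_succ]
          ring
        have h2 : 0 ≤ φ s N - φ s (N + 1) := sub_nonneg.2 (hanti s (Nat.le_succ N))
        rw [h1]
        refine (abs_add_le _ _).trans ?_
        rw [abs_mul _ (φ s N - φ s (N + 1)), abs_of_nonneg h2]
        have := mul_le_mul_of_nonneg_right (hD (N + 1) (by omega)) h2
        linarith
    have hb : ∀ N, K ≤ N → |∑ n ∈ Finset.range N, c n * φ s n
        - ∑ n ∈ Finset.range K, c n * φ s n| ≤ 2 * ε := by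
      intro N hN
      have h1 := hind N hN
      have h2 : |(∑ n ∈ Finset.range N, c n - S) * φ s N| ≤ ε * φ s N := by
        rw [abs_mul, abs_of_nonneg (hpos s N)]
        exact mul_le_mul_of_nonneg_right (hD N hN) (hpos s N)
      have h3 := mul_le_mul_of_nonneg_left (hle s K) hε.le
      have h4 := abs_le.1 h1
      have h5 := abs_le.1 h2
      rw [abs_le]
      constructor <;> linarith
    have ht := (((hsum s).hasSum.tendsto_sum_nat).sub_const
      (∑ n ∈ Finset.range K, c n * φ s n)).abs
    exact le_of_tendsto ht (eventually_atTop.2 ⟨K, hb⟩)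
  have hfin : Tendsto (fun s => ∑ n ∈ Finset.range K, c n * φ s n) atTop
      (𝓝 (∑ n ∈ Finset.range K, c n * 1)) :=
    tendsto_finsetSum _ fun n _ => (hlim n).const_mul _
  simp only [mul_one] at hfin
  obtain ⟨N, hN⟩ := Metric.tendsto_atTop.1 hfin ε hε
  refine ⟨N, fun s hs => ?_⟩
  have h1 := abs_le.1 (htail s)
  have h2 := abs_lt.1 (hN s hs)
  have h3 := abs_le.1 (hD K le_rfl)
  rw [Real.dist_eq, abs_lt]
  constructor <;> linarith

/-- The symbol of the resolvent of the Laplacian on `S^d`. -/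
noncomputable def resolventFactor (d : ℕ) (s : ℝ) (n : ℕ) : ℝ := 1 / (1 + s * laplaceEigenvalue d n)

section
variable {d : ℕ}

lemma laplaceEigenvalue_mono (hd : 1 ≤ d) : Monotone (laplaceEigenvalue d) := by
  intro k n h
  rcases h.lt_or_eq with h | rfl
  · exact (laplaceEigenvalue_lt hd h).le
  · exact le_rfl

lemma one_le_one_add_mul_laplaceEigenvalue (hd : 1 ≤ d) {s : ℝ} (hs : 0 ≤ s) (n : ℕ) :
    1 ≤ 1 + s * laplaceEigenvalue d n := by
  linarith [mul_nonneg hs (laplaceEigenvalue_nonneg hd n)]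

lemma resolventFactor_pos (hd : 1 ≤ d) {s : ℝ} (hs : 0 ≤ s) (n : ℕ) :
    0 < resolventFactor d s n := by
  have := one_le_one_add_mul_laplaceEigenvalue hd hs n
  unfold resolventFactor
  positivity

lemma resolventFactor_le_one (hd : 1 ≤ d) {s : ℝ} (hs : 0 ≤ s) (n : ℕ) :
    resolventFactor d s n ≤ 1 := by
  have := one_le_one_add_mul_laplaceEigenvalue hd hs n
  unfold resolventFactor
  rw [div_le_one (by linarith)]
  exact this

lemma resolventFactor_antitone (hd : 1 ≤ d) {s : ℝ} (hs : 0 ≤ s) :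
    Antitone (resolventFactor d s) := by
  intro k n h
  have := one_le_one_add_mul_laplaceEigenvalue hd hs k
  have h2 := mul_le_mul_of_nonneg_left (laplaceEigenvalue_mono hd h) hs
  unfold resolventFactor
  exact one_div_le_one_div_of_le (by linarith) (by linarith)

lemma one_sub_resolventFactor (hd : 1 ≤ d) {s : ℝ} (hs : 0 ≤ s) (n : ℕ) :
    1 - resolventFactor d s n = s * (laplaceEigenvalue d n * resolventFactor d s n) := by
  have := one_le_one_add_mul_laplaceEigenvalue hd hs n
  unfold resolventFactor
  field_simp
  ring

/-- Since `d ≥ 1`, the eigenvalues are at least `n²`; thus one resolvent makes any bounded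
coefficient sequence summable. -/
lemma summable_resolventFactor (hd : 1 ≤ d) {s : ℝ} (hs : 0 < s) :
    Summable (resolventFactor d s) := by
  rw [← summable_nat_add_iff 1]
  have h1 : Summable fun n : ℕ => s⁻¹ * (1 / ((n + 1 : ℕ) : ℝ) ^ 2) :=
    ((summable_nat_add_iff 1).2 (Real.summable_one_div_nat_pow.2 one_lt_two)).mul_left _
  refine Summable.of_nonneg_of_le (fun n => (resolventFactor_pos hd hs.le _).le) (fun n => ?_) h1
  have hd' : (1 : ℝ) ≤ d := by exact_mod_cast hd
  have h2 : ((n + 1 : ℕ) : ℝ) ^ 2 ≤ laplaceEigenvalue d (n + 1) := by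
    unfold laplaceEigenvalue
    have : (0 : ℝ) < ((n + 1 : ℕ) : ℝ) := by positivity
    nlinarith
  unfold resolventFactor
  rw [← one_div, one_div_mul_one_div]
  have h3 : (0 : ℝ) < ((n + 1 : ℕ) : ℝ) ^ 2 := by positivity
  exact one_div_le_one_div_of_le (by positivity)
    (by linarith [mul_le_mul_of_nonneg_left h2 hs.le])

lemma tendsto_resolventFactor (n : ℕ) :
    Tendsto (fun j : ℕ => resolventFactor d (1 / ((j : ℝ) + 1)) n) atTop (𝓝 1) := by
  have h : Tendsto (fun j : ℕ => 1 + 1 / ((j : ℝ) + 1) * laplaceEigenvalue d n) atTop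
      (𝓝 (1 + 0 * laplaceEigenvalue d n)) :=
    (tendsto_one_div_add_atTop_nhds_zero_nat.mul_const _).const_add _
  have h2 := h.inv₀ (by norm_num)
  simpa [resolventFactor] using h2

/-- The resolvent regularisation of a zonal series. -/
noncomputable def resolventSum (d : ℕ) (b : ℕ → ℝ) (s x : ℝ) : ℝ :=
  ∑' n, b n * (zonalPoly d n).eval x * resolventFactor d s n

variable {b : ℕ → ℝ} {f : ℝ → ℝ}

/-- At `x = 1` every `p_n` equals `1`, so the `b n` are terms of a convergent series. -/
lemma exists_coeff_bound (hd : 1 ≤ d)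
    (hb : Tendsto (fun N => ∑ n ∈ Finset.range N, b n * (zonalPoly d n).eval 1) atTop (𝓝 (f 1))) :
    ∃ A, ∀ n, |b n| ≤ A := by
  simp only [zonalPoly_eval_one hd, mul_one] at hb
  obtain ⟨A, hA⟩ := (Metric.isBounded_range_of_tendsto _ hb).exists_norm_le
  refine ⟨A + A, fun n => ?_⟩
  have h1 := hA _ ⟨n + 1, rfl⟩
  have h2 := hA _ ⟨n, rfl⟩
  have h3 : b n = ∑ k ∈ Finset.range (n + 1), b k - ∑ k ∈ Finset.range n, b k := by
    rw [Finset.sum_range_succ]; ring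
  rw [h3]
  exact (norm_sub_le _ _).trans (add_le_add h1 h2)

lemma summable_mul_resolventFactor (hd : 1 ≤ d) {c : ℕ → ℝ} {A : ℝ} (hA : ∀ n, |c n| ≤ A)
    {s : ℝ} (hs : 0 < s) : Summable fun n => c n * resolventFactor d s n := by
  refine Summable.of_norm_bounded ((summable_resolventFactor hd hs).mul_left A) fun n => ?_
  rw [norm_mul, Real.norm_eq_abs, Real.norm_eq_abs, abs_of_pos (resolventFactor_pos hd hs.le n)]
  exact mul_le_mul_of_nonneg_right (hA n) (resolventFactor_pos hd hs.le n).le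

lemma abs_mul_zonalPoly_le (hd : 1 ≤ d) {A : ℝ} (hA : ∀ n, |b n| ≤ A) {x : ℝ}
    (hx : x ∈ Set.Icc (-1 : ℝ) 1) (n : ℕ) : |b n * (zonalPoly d n).eval x| ≤ A := by
  rw [abs_mul, ← mul_one A]
  exact mul_le_mul (hA n) (abs_zonalPoly_eval_le_one hd n hx) (abs_nonneg _)
    ((abs_nonneg _).trans (hA n))

lemma norm_resolventTerm_le (hd : 1 ≤ d) {A : ℝ} (hA : ∀ n, |b n| ≤ A) {s : ℝ} (hs : 0 < s)
    (n : ℕ) {x : ℝ} (hx : x ∈ Set.Icc (-1 : ℝ) 1) :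
    ‖b n * (zonalPoly d n).eval x * resolventFactor d s n‖ ≤ A * resolventFactor d s n := by
  rw [norm_mul, Real.norm_eq_abs, Real.norm_eq_abs, abs_of_pos (resolventFactor_pos hd hs.le n)]
  exact mul_le_mul_of_nonneg_right (abs_mul_zonalPoly_le hd hA hx n)
    (resolventFactor_pos hd hs.le n).le

lemma continuousOn_resolventSum (hd : 1 ≤ d) {A : ℝ} (hA : ∀ n, |b n| ≤ A) {s : ℝ} (hs : 0 < s) :
    ContinuousOn (resolventSum d b s) (Set.Icc (-1) 1) :=
  continuousOn_tsum
    (fun n => ((continuous_const.mul (zonalPoly d n).continuous).mul continuous_const).continuousOn)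
    ((summable_resolventFactor hd hs).mul_left A) fun n _ hx => norm_resolventTerm_le hd hA hs n hx

/-- Resolvents of continuous zonal series preserve upper bounds. -/
lemma tsum_resolventFactor_mul_le (hd : 1 ≤ d) {A : ℝ} (hA : ∀ n, |b n| ≤ A) {s t : ℝ}
    (hs : 0 < s) (ht : 0 < t) {U : ℝ}
    (hU : ∀ x ∈ Set.Icc (-1 : ℝ) 1, resolventSum d b s x ≤ U) {x : ℝ}
    (hx : x ∈ Set.Icc (-1 : ℝ) 1) :
    ∑' n, b n * (zonalPoly d n).eval x * resolventFactor d s n * resolventFactor d t n ≤ U := by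
  -- Uniform convergence lets the polynomial maximum principle be applied to partial sums with bound
  -- `U + ε`.
  have hunif := tendstoUniformlyOn_tsum_nat ((summable_resolventFactor hd hs).mul_left A)
    (f := fun n x => b n * (zonalPoly d n).eval x * resolventFactor d s n)
    fun n x hx => norm_resolventTerm_le hd hA hs n hx
  have hsum : Summable fun n =>
      b n * (zonalPoly d n).eval x * resolventFactor d s n * resolventFactor d t n :=
    summable_mul_resolventFactor hd (A := A) (fun n => by
      refine (norm_resolventTerm_le hd hA hs n hx).trans ?_
      have h0 : 0 ≤ A := (abs_nonneg _).trans (hA 0)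
      nlinarith [resolventFactor_le_one hd hs.le n]) ht
  refine le_of_forall_pos_le_add fun ε hε => ?_
  refine le_of_tendsto hsum.hasSum.tendsto_sum_nat ?_
  filter_upwards [Metric.tendstoUniformlyOn_iff.1 hunif ε hε] with N hN
  have := resolvent_sum_le hd ht.le (Finset.range N) (fun n => b n * resolventFactor d s n)
    (M := U + ε) (fun y hy => by
      have h1 := abs_lt.1 (hN y hy)
      have h2 := hU y hy
      rw [resolventSum] at h2
      have h3 : ∑ n ∈ Finset.range N, b n * resolventFactor d s n * (zonalPoly d n).eval y
          = ∑ n ∈ Finset.range N, b n * (zonalPoly d n).eval y * resolventFactor d s n :=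
        Finset.sum_congr rfl fun n _ => by ring
      rw [h3]
      linarith [h1.1]) x hx
  refine le_trans (le_of_eq ?_) this
  refine Finset.sum_congr rfl fun n _ => ?_
  rw [resolventFactor.eq_1 d t]
  ring

/-- The maximum principle for pointwise convergent zonal series. -/
lemma resolventSum_le (hd : 1 ≤ d)
    (hf : ∀ x ∈ Set.Icc (-1 : ℝ) 1,
      Tendsto (fun N => ∑ n ∈ Finset.range N, b n * (zonalPoly d n).eval x) atTop (𝓝 (f x)))
    {M : ℝ} (hM : ∀ x ∈ Set.Icc (-1 : ℝ) 1, f x ≤ M) {s : ℝ} (hs : 0 < s) :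
    ∀ x ∈ Set.Icc (-1 : ℝ) 1, resolventSum d b s x ≤ M := by
  obtain ⟨A, hA⟩ := exists_coeff_bound hd (hf 1 (by norm_num))
  obtain ⟨y, hy, hmax⟩ := isCompact_Icc.exists_isMaxOn (Set.nonempty_Icc.2 (by norm_num))
    (continuousOn_resolventSum hd hA hs)
  intro x hx
  refine le_trans (b := resolventSum d b s y) (hmax hx) (le_trans ?_ (hM y hy))
  -- With `u` the regularised sum, maximal at `y`, these are the formal terms of `-Δu (y)`. Their
  -- series converges to `s⁻¹ (f y - u y)`, so it is enough to show that this sum is nonnegative.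
  set c : ℕ → ℝ := fun n =>
    b n * (zonalPoly d n).eval y * (laplaceEigenvalue d n * resolventFactor d s n) with hc
  have hcs : ∀ n, c n = s⁻¹ * (b n * (zonalPoly d n).eval y
      - b n * (zonalPoly d n).eval y * resolventFactor d s n) := by
    intro n
    have h1 := one_sub_resolventFactor hd hs.le n
    have h2 : b n * (zonalPoly d n).eval y
      - b n * (zonalPoly d n).eval y * resolventFactor d s n
      = b n * (zonalPoly d n).eval y * (1 - resolventFactor d s n) := by ring
    rw [h2, h1, hc]
    field_simp
  have hbs : Summable fun n => b n * (zonalPoly d n).eval y * resolventFactor d s n :=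
    summable_mul_resolventFactor hd (abs_mul_zonalPoly_le hd hA hy) hs
  have hclim : Tendsto (fun N => ∑ n ∈ Finset.range N, c n) atTop
      (𝓝 (s⁻¹ * (f y - resolventSum d b s y))) := by
    have := ((hf y hy).sub hbs.hasSum.tendsto_sum_nat).const_mul s⁻¹
    refine this.congr fun N => ?_
    rw [← Finset.sum_sub_distrib, Finset.mul_sum]
    exact Finset.sum_congr rfl fun n _ => (hcs n).symm
  have hcA : ∀ n, |c n| ≤ s⁻¹ * (A + A) := by
    intro n
    rw [hcs, abs_mul, abs_of_pos (inv_pos.2 hs)]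
    refine mul_le_mul_of_nonneg_left ?_ (inv_pos.2 hs).le
    refine (abs_sub _ _).trans (add_le_add (abs_mul_zonalPoly_le hd hA hy n) ?_)
    refine (norm_resolventTerm_le hd hA hs n hy).trans ?_
    have h0 : 0 ≤ A := (abs_nonneg _).trans (hA 0)
    nlinarith [resolventFactor_le_one hd hs.le n]
  have hstep : ∀ j : ℕ, (0 : ℝ) < 1 / ((j : ℝ) + 1) := fun j => by positivity
  have hlim := tendsto_tsum_mul_of_antitone hclim
    (φ := fun j => resolventFactor d (1 / ((j : ℝ) + 1)))
    (fun j => resolventFactor_antitone hd (hstep j).le)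
    (fun j n => (resolventFactor_pos hd (hstep j).le n).le)
    (fun j n => resolventFactor_le_one hd (hstep j).le n) tendsto_resolventFactor
    (fun j => summable_mul_resolventFactor hd hcA (hstep j))
  -- Damping by a second resolvent with `t = 1 / (j + 1)` turns the sum into `t⁻¹ (u y - R_t u y)`,
  -- where `R_t` denotes that resolvent. This is nonnegative because `R_t u` stays below the maximum
  -- `u y`; then `t → 0` by Abel summation.
  have hnonneg : ∀ j : ℕ, 0 ≤ ∑' n, c n * resolventFactor d (1 / ((j : ℝ) + 1)) n := by
    intro j
    have h1 := tsum_resolventFactor_mul_le hd hA hs (hstep j) (fun x hx => hmax hx) hy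
    have hs2 : Summable fun n => b n * (zonalPoly d n).eval y * resolventFactor d s n
        * resolventFactor d (1 / ((j : ℝ) + 1)) n :=
      summable_mul_resolventFactor hd (A := A) (fun n => by
        refine (norm_resolventTerm_le hd hA hs n hy).trans ?_
        have h0 : 0 ≤ A := (abs_nonneg _).trans (hA 0)
        nlinarith [resolventFactor_le_one hd hs.le n]) (hstep j)
    have h2 : ∀ n, c n * resolventFactor d (1 / ((j : ℝ) + 1)) n
        = (1 / ((j : ℝ) + 1))⁻¹ * (b n * (zonalPoly d n).eval y * resolventFactor d s n
          - b n * (zonalPoly d n).eval y * resolventFactor d s n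
            * resolventFactor d (1 / ((j : ℝ) + 1)) n) := by
      intro n
      have h3 := one_sub_resolventFactor hd (hstep j).le n
      have h4 : b n * (zonalPoly d n).eval y * resolventFactor d s n
          - b n * (zonalPoly d n).eval y * resolventFactor d s n
            * resolventFactor d (1 / ((j : ℝ) + 1)) n
          = b n * (zonalPoly d n).eval y * resolventFactor d s n
            * (1 - resolventFactor d (1 / ((j : ℝ) + 1)) n) := by ring
      have h5 := (hstep j).ne'
      rw [h4, h3, hc]
      generalize 1 / ((j : ℝ) + 1) = t at *
      field_simp
    simp_rw [h2]
    rw [tsum_mul_left, hbs.tsum_sub hs2]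
    refine mul_nonneg (inv_pos.2 (hstep j)).le (sub_nonneg.2 ?_)
    exact h1
  have h6 := ge_of_tendsto' hlim hnonneg
  have h7 := nonneg_of_mul_nonneg_right h6 (inv_pos.2 hs)
  linarith

end

/-! ### Integrals and operations on positive definite kernels -/

/-- A positive definite kernel whose sections all have the same integral has a nonnegative one. -/
lemma IsPosDefKernel.integral_nonneg {X : Type} [MeasurableSpace X] {μ : Measure X}
    [IsFiniteMeasure μ] (hμ : μ ≠ 0) {K : X → X → ℝ} (hK : IsPosDefKernel K) {I M : ℝ}
    (hint : ∀ x, Integrable (K x) μ) (hI : ∀ x, ∫ y, K x y ∂μ = I) (hM : ∀ x, K x x ≤ M) :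
    0 ≤ I := by
  obtain ⟨H, _, _, _, k, hk⟩ := hK.exists_feature
  have hμ0 : 0 < μ.real Set.univ := by
    rw [measureReal_def, ENNReal.toReal_pos_iff]
    exact ⟨by simpa [pos_iff_ne_zero] using hμ, measure_lt_top _ _⟩
  set J : ℝ := (μ.real Set.univ)⁻¹ * I with hJ
  -- Points are chosen greedily, each with inner product against the current sum `v` at most the
  -- average `N J`. This needs only integrable sections, not joint measurability. If `J < 0`, the
  -- bound on `‖v‖ ^ 2` eventually becomes negative.
  have hstep : ∀ N : ℕ, ∃ v : H, ‖v‖ ^ 2 ≤ N * (N - 1) * J + N * M ∧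
      Integrable (fun y => inner ℝ v (k y)) μ ∧ ∫ y, inner ℝ v (k y) ∂μ = N * I := by
    intro N
    induction N with
    | zero => exact ⟨0, by simp⟩
    | succ N ih =>
      obtain ⟨v, hv, hvi, hvI⟩ := ih
      obtain ⟨y, hy⟩ := exists_le_average hμ hvi
      rw [average_eq, hvI, smul_eq_mul] at hy
      refine ⟨v + k y, ?_, ?_, ?_⟩
      · have h1 : ‖k y‖ ^ 2 ≤ M := by
          rw [← real_inner_self_eq_norm_sq, hk]
          exact hM y
        have h2 : (μ.real Set.univ)⁻¹ * (N * I) = N * J := by rw [hJ]; ring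
        rw [norm_add_sq_real]
        push_cast
        rw [h2] at hy
        linarith
      · simp only [inner_add_left, hk]
        exact hvi.add (hint y)
      · simp only [inner_add_left, hk]
        rw [integral_add hvi (hint y), hvI, hI]
        push_cast
        ring
  by_contra hneg
  have hJneg : J < 0 := mul_neg_of_pos_of_neg (inv_pos.2 hμ0) (not_le.1 hneg)
  obtain ⟨N, hN⟩ := exists_nat_gt (M / (-J))
  obtain ⟨v, hv, -⟩ := hstep (N + 1)
  rw [div_lt_iff₀ (by linarith)] at hN
  have h1 := (sq_nonneg ‖v‖).trans hv
  push_cast at h1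
  have h2 : (0 : ℝ) < (N : ℝ) + 1 := by positivity
  nlinarith

lemma isPosDefKernel_inner {ι H : Type} [NormedAddCommGroup H] [InnerProductSpace ℝ H] (k : ι → H) :
    IsPosDefKernel fun i j => inner ℝ (k i) (k j) := by
  refine ⟨fun i j => real_inner_comm _ _, fun s w => ?_⟩
  have : ∑ i ∈ s, ∑ j ∈ s, w i * w j * inner ℝ (k i) (k j)
      = inner ℝ (∑ i ∈ s, w i • k i) (∑ i ∈ s, w i • k i) := by
    simp only [sum_inner, inner_sum, real_inner_smul_left, real_inner_smul_right]
    rw [Finset.sum_comm]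
    refine Finset.sum_congr rfl fun i _ => Finset.sum_congr rfl fun j _ => ?_
    rw [real_inner_comm]
    ring
  rw [this]
  exact real_inner_self_nonneg

lemma IsPosDefKernel.comp {ι κ : Type} {K : ι → ι → ℝ} (hK : IsPosDefKernel K) (φ : κ → ι) :
    IsPosDefKernel fun a b => K (φ a) (φ b) := by
  obtain ⟨H, _, _, _, k, hk⟩ := hK.exists_feature
  simpa only [hk] using isPosDefKernel_inner fun a => k (φ a)

lemma IsPosDefKernel.self_nonneg {ι : Type} {K : ι → ι → ℝ} (hK : IsPosDefKernel K) (i : ι) :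
    0 ≤ K i i := by
  simpa using hK.nonneg {i} 1

lemma IsPosDefKernel.abs_le {ι : Type} {K : ι → ι → ℝ} (hK : IsPosDefKernel K) (i j : ι) :
    |K i j| ≤ (K i i + K j j) / 2 := by
  obtain ⟨H, _, _, _, k, hk⟩ := hK.exists_feature
  have h1 := abs_real_inner_le_norm (k i) (k j)
  have h2 := real_inner_self_eq_norm_sq (k i)
  have h3 := real_inner_self_eq_norm_sq (k j)
  rw [hk] at h1 h2 h3
  nlinarith [sq_nonneg (‖k i‖ - ‖k j‖)]

/-! ### Fourier coefficients and Schoenberg's theorem -/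

section
variable {d : ℕ} {b : ℕ → ℝ} {f : ℝ → ℝ}

lemma zonalIntegral_zonalPoly_mul_zonalPoly (hd : 1 ≤ d) {k n : ℕ} (h : k ≠ n) :
    zonalIntegral d (zonalPoly d k * zonalPoly d n) = 0 := by
  rcases h.lt_or_gt with h | h
  · rw [mul_comm]
    exact zonalIntegral_zonalPoly_mul hd ((zonalPoly_natDegree_le k).trans_lt h)
  · exact zonalIntegral_zonalPoly_mul hd ((zonalPoly_natDegree_le n).trans_lt h)

/-- The regularised series is absolutely summable uniformly in `y`, so it can be integrated termwise
and orthogonality leaves one term. -/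
lemma integral_resolventSum_mul (hd : 1 ≤ d) {A : ℝ} (hA : ∀ n, |b n| ≤ A) {s : ℝ} (hs : 0 < s)
    (x : UnitSphere d) (n : ℕ) :
    ∫ y : UnitSphere d, resolventSum d b s (inner ℝ (x : EuclideanSpace ℝ (Fin (d + 1))) y)
        * (zonalPoly d n).eval (inner ℝ (x : EuclideanSpace ℝ (Fin (d + 1))) y) ∂(sphereMeasure d)
      = b n * resolventFactor d s n * zonalNorm d n := by
  set F : ℕ → UnitSphere d → ℝ := fun k y =>
    b k * (zonalPoly d k).eval (inner ℝ (x : EuclideanSpace ℝ (Fin (d + 1))) y)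
      * resolventFactor d s k
      * (zonalPoly d n).eval (inner ℝ (x : EuclideanSpace ℝ (Fin (d + 1))) y) with hF
  have hFi : ∀ k, Integrable (F k) (sphereMeasure d) := fun k =>
    integrable_sphere (((continuous_const.mul (continuous_eval_inner _ _)).mul
      continuous_const).mul (continuous_eval_inner _ _))
  have hFb : ∀ k y, ‖F k y‖ ≤ A * resolventFactor d s k := by
    intro k y
    have h1 := norm_resolventTerm_le hd hA hs k (inner_mem_Icc x y)
    have h2 := abs_zonalPoly_eval_le_one hd n (inner_mem_Icc x y)
    rw [hF, norm_mul, ← mul_one (A * _)]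
    exact mul_le_mul h1 h2 (norm_nonneg _) ((norm_nonneg _).trans h1)
  have hsum : Summable fun k => ∫ y, ‖F k y‖ ∂(sphereMeasure d) := by
    refine Summable.of_nonneg_of_le (fun k => MeasureTheory.integral_nonneg fun _ => norm_nonneg _)
      (fun k => integral_mono (hFi k).norm (integrable_const _) (hFb k)) ?_
    simp only [integral_const, smul_eq_mul]
    exact ((summable_resolventFactor hd hs).mul_left A).mul_left _
  have h1 := hasSum_integral_of_summable_integral_norm hFi hsum
  have h2 : ∀ k, ∫ y, F k y ∂(sphereMeasure d)
      = b k * resolventFactor d s k * zonalIntegral d (zonalPoly d k * zonalPoly d n) := by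
    intro k
    rw [← integral_eval_inner hd (norm_eq_of_mem_sphere x), ← integral_const_mul]
    refine integral_congr_ae (Eventually.of_forall fun y => ?_)
    simp only [hF, Polynomial.eval_mul]
    ring
  have h3 : HasSum (fun k => ∫ y, F k y ∂(sphereMeasure d))
      (b n * resolventFactor d s n * zonalNorm d n) := by
    have := hasSum_single (f := fun k => ∫ y, F k y ∂(sphereMeasure d)) n fun k hk => by
      rw [h2, zonalIntegral_zonalPoly_mul_zonalPoly hd hk, mul_zero]
    rwa [h2] at this
  rw [← h1.unique h3]
  refine integral_congr_ae (Eventually.of_forall fun y => ?_)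
  simp only [hF, resolventSum]
  rw [tsum_mul_right]

/-- The coefficients of a bounded pointwise convergent zonal series are Fourier coefficients. -/
lemma integrable_and_integral_mul_zonalPoly (hd : 1 ≤ d)
    (hf : ∀ x ∈ Set.Icc (-1 : ℝ) 1,
      Tendsto (fun N => ∑ n ∈ Finset.range N, b n * (zonalPoly d n).eval x) atTop (𝓝 (f x)))
    {M : ℝ} (hM : ∀ x ∈ Set.Icc (-1 : ℝ) 1, |f x| ≤ M) (x : UnitSphere d) (n : ℕ) :
    Integrable (fun y : UnitSphere d => f (inner ℝ (x : EuclideanSpace ℝ (Fin (d + 1))) y)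
        * (zonalPoly d n).eval (inner ℝ (x : EuclideanSpace ℝ (Fin (d + 1))) y))
      (sphereMeasure d) ∧
    ∫ y : UnitSphere d, f (inner ℝ (x : EuclideanSpace ℝ (Fin (d + 1))) y)
        * (zonalPoly d n).eval (inner ℝ (x : EuclideanSpace ℝ (Fin (d + 1))) y) ∂(sphereMeasure d)
      = b n * zonalNorm d n := by
  obtain ⟨A, hA⟩ := exists_coeff_bound hd (hf 1 (by norm_num))
  have hstep : ∀ j : ℕ, (0 : ℝ) < 1 / ((j : ℝ) + 1) := fun j => by positivity
  have hfn : ∀ x ∈ Set.Icc (-1 : ℝ) 1, Tendsto (fun N => ∑ n ∈ Finset.range N,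
      (-b n) * (zonalPoly d n).eval x) atTop (𝓝 (-f x)) := fun x hx => by
    simpa using (hf x hx).neg
  -- The maximum principle bounds from above only, so it is applied to `f` and to `-f`; this uniform
  -- bound is the dominating constant below.
  have hRM : ∀ j : ℕ, ∀ c ∈ Set.Icc (-1 : ℝ) 1, |resolventSum d b (1 / ((j : ℝ) + 1)) c| ≤ M := by
    intro j c hc
    have h1 := resolventSum_le hd hf (fun x hx => (abs_le.1 (hM x hx)).2) (hstep j) c hc
    have h2 := resolventSum_le hd (f := fun x => -f x) hfn (M := M)
      (fun x hx => by linarith [(abs_le.1 (hM x hx)).1]) (hstep j) c hc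
    have h3 : resolventSum d (fun n => -b n) (1 / ((j : ℝ) + 1)) c
        = -resolventSum d b (1 / ((j : ℝ) + 1)) c := by
      simp [resolventSum, tsum_neg]
    exact abs_le.2 ⟨by linarith, h1⟩
  have hlim : ∀ c ∈ Set.Icc (-1 : ℝ) 1,
      Tendsto (fun j : ℕ => resolventSum d b (1 / ((j : ℝ) + 1)) c) atTop (𝓝 (f c)) :=
    fun c hc => tendsto_tsum_mul_of_antitone (hf c hc)
      (φ := fun j => resolventFactor d (1 / ((j : ℝ) + 1)))
      (fun j => resolventFactor_antitone hd (hstep j).le)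
      (fun j n => (resolventFactor_pos hd (hstep j).le n).le)
      (fun j n => resolventFactor_le_one hd (hstep j).le n) tendsto_resolventFactor
      (fun j => summable_mul_resolventFactor hd (abs_mul_zonalPoly_le hd hA hc) (hstep j))
  have hmeas : ∀ j : ℕ, AEStronglyMeasurable (fun y : UnitSphere d =>
      resolventSum d b (1 / ((j : ℝ) + 1)) (inner ℝ (x : EuclideanSpace ℝ (Fin (d + 1))) y)
        * (zonalPoly d n).eval (inner ℝ (x : EuclideanSpace ℝ (Fin (d + 1))) y))
      (sphereMeasure d) := by
    intro j
    refine Continuous.aestronglyMeasurable (Continuous.mul ?_ (continuous_eval_inner _ _))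
    exact (continuousOn_resolventSum hd hA (hstep j)).comp_continuous (by fun_prop)
      fun y => inner_mem_Icc x y
  have hbound : ∀ g : ℝ, |g| ≤ M → ∀ y : UnitSphere d,
      ‖g * (zonalPoly d n).eval (inner ℝ (x : EuclideanSpace ℝ (Fin (d + 1))) y)‖ ≤ M := by
    intro g hg y
    rw [norm_mul, ← mul_one M]
    exact mul_le_mul hg (abs_zonalPoly_eval_le_one hd n (inner_mem_Icc x y)) (norm_nonneg _)
      ((abs_nonneg _).trans hg)
  have hpt : ∀ y : UnitSphere d, Tendsto (fun j : ℕ =>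
      resolventSum d b (1 / ((j : ℝ) + 1)) (inner ℝ (x : EuclideanSpace ℝ (Fin (d + 1))) y)
        * (zonalPoly d n).eval (inner ℝ (x : EuclideanSpace ℝ (Fin (d + 1))) y)) atTop
      (𝓝 (f (inner ℝ (x : EuclideanSpace ℝ (Fin (d + 1))) y)
        * (zonalPoly d n).eval (inner ℝ (x : EuclideanSpace ℝ (Fin (d + 1))) y))) :=
    fun y => (hlim _ (inner_mem_Icc x y)).mul_const _
  refine ⟨Integrable.of_bound (aestronglyMeasurable_of_tendsto_ae atTop hmeas
    (Eventually.of_forall hpt)) M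
    (Eventually.of_forall fun y => hbound _ (hM _ (inner_mem_Icc x y)) y), ?_⟩
  have hint := tendsto_integral_of_dominated_convergence (fun _ => M) hmeas (integrable_const M)
    (fun j => Eventually.of_forall fun y => hbound _ (hRM j _ (inner_mem_Icc x y)) y)
    (Eventually.of_forall hpt)
  simp only [fun j : ℕ => integral_resolventSum_mul hd hA (hstep j) x n] at hint
  refine tendsto_nhds_unique hint ?_
  simpa using ((tendsto_resolventFactor (d := d) n).const_mul (b n)).mul_const (zonalNorm d n)

/-- Schoenberg's theorem for pointwise convergent zonal series. -/
theorem coeff_nonneg_of_isPosDefKernel (hd : 1 ≤ d)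
    (hf : ∀ x ∈ Set.Icc (-1 : ℝ) 1,
      Tendsto (fun N => ∑ n ∈ Finset.range N, b n * (zonalPoly d n).eval x) atTop (𝓝 (f x)))
    (hK : IsPosDefKernel fun x y : UnitSphere d =>
      f (inner ℝ (x : EuclideanSpace ℝ (Fin (d + 1))) y)) (n : ℕ) : 0 ≤ b n := by
  have hself : ∀ x : UnitSphere d,
      inner ℝ (x : EuclideanSpace ℝ (Fin (d + 1))) (x : EuclideanSpace ℝ (Fin (d + 1))) = (1 : ℝ) :=
    fun x => by rw [real_inner_self_eq_norm_sq, norm_eq_of_mem_sphere x, one_pow]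
  -- Boundedness of `f`, which pointwise convergence alone does not give, comes from positive
  -- definiteness.
  have hM : ∀ c ∈ Set.Icc (-1 : ℝ) 1, |f c| ≤ f 1 := by
    intro c hc
    obtain ⟨y, hy⟩ := exists_inner_eq hd (northPole d) hc
    have := hK.abs_le (northPole d) y
    rw [hself, hself, hy] at this
    linarith
  have hKn : IsPosDefKernel fun x y : UnitSphere d =>
      f (inner ℝ (x : EuclideanSpace ℝ (Fin (d + 1))) y)
        * (zonalPoly d n).eval (inner ℝ (x : EuclideanSpace ℝ (Fin (d + 1))) y) :=
    ⟨fun x y => by rw [real_inner_comm], fun s w =>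
      sum_mul_zonalPoly_nonneg hd (fun x => x) s (hK.nonneg s) n w⟩
  have hμ : sphereMeasure d ≠ 0 := by
    intro h
    have h1 := isOpen_univ.measure_pos (sphereMeasure d) ⟨northPole d, trivial⟩
    simp [h] at h1
  have h := hKn.integral_nonneg (I := b n * zonalNorm d n) (M := f 1) hμ
    (fun x => (integrable_and_integral_mul_zonalPoly hd hf hM x n).1)
    (fun x => (integrable_and_integral_mul_zonalPoly hd hf hM x n).2)
    (fun x => by rw [hself, zonalPoly_eval_one hd, mul_one])
  exact nonneg_of_mul_nonneg_left h (zonalNorm_pos hd n)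

end

/-! ### Matrix-valued zonal expansions -/

section
variable {ι : Type}

lemma IsPosDefKernel.of_tendsto {K : ℕ → ι → ι → ℝ} {L : ι → ι → ℝ}
    (hK : ∀ N, IsPosDefKernel (K N))
    (hL : ∀ i j, Tendsto (fun N => K N i j) atTop (𝓝 (L i j))) : IsPosDefKernel L :=
  ⟨fun i j => tendsto_nhds_unique (hL i j) (by simpa only [(hK _).symm i j] using hL j i),
    fun s w => ge_of_tendsto' (tendsto_finsetSum s fun i _ => tendsto_finsetSum s fun j _ =>
      (hL i j).const_mul (w i * w j)) fun N => (hK N).nonneg s w⟩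

lemma IsPosDefKernel.sum {κ : Type} {K : κ → ι → ι → ℝ} (hK : ∀ n, IsPosDefKernel (K n))
    (F : Finset κ) : IsPosDefKernel fun i j => ∑ n ∈ F, K n i j := by
  refine ⟨fun i j => Finset.sum_congr rfl fun n _ => (hK n).symm i j, fun s w => ?_⟩
  have : ∑ i ∈ s, ∑ j ∈ s, w i * w j * ∑ n ∈ F, K n i j
      = ∑ n ∈ F, ∑ i ∈ s, ∑ j ∈ s, w i * w j * K n i j := by
    simp_rw [Finset.mul_sum]
    rw [Finset.sum_comm]
    refine (Finset.sum_congr rfl fun i _ => Finset.sum_comm).trans ?_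
    rw [Finset.sum_comm]
    exact Finset.sum_congr rfl fun n _ => Finset.sum_comm
  rw [this]
  exact Finset.sum_nonneg fun n _ => (hK n).nonneg s w

end

section
variable {T : Type} {m d : ℕ} {g : ℕ → ℝ → ℝ} {q : ℕ → ℝ}
  {B : ℕ → T → Matrix (Fin m) (Fin m) ℝ} {C : ℝ → T → Matrix (Fin m) (Fin m) ℝ}

lemma seriesTendsTo_iff {A : ℕ → Matrix (Fin m) (Fin m) ℝ} {S : Matrix (Fin m) (Fin m) ℝ} :
    SeriesTendsTo A S ↔
      ∀ i j, Tendsto (fun N => ∑ n ∈ Finset.range N, A n i j) atTop (𝓝 (S i j)) := by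
  simp only [SeriesTendsTo, ← Matrix.sum_apply]
  exact tendsto_pi_nhds.trans (forall_congr' fun i => tendsto_pi_nhds)

lemma IsSeriesExpansion.tendsto_entry (hC : IsSeriesExpansion g B C)
    (hg : ∀ n ϑ, g n ϑ = q n * (zonalPoly d n).eval (Real.cos ϑ)) {x : ℝ}
    (hx : x ∈ Set.Icc (-1 : ℝ) 1) (t : T) (i j : Fin m) :
    Tendsto (fun N => ∑ n ∈ Finset.range N, q n * B n t i j * (zonalPoly d n).eval x) atTop
      (𝓝 (C (Real.arccos x) t i j)) := by
  have := seriesTendsTo_iff.1 (hC _ ⟨Real.arccos_nonneg x, Real.arccos_le_pi x⟩ t) i j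
  refine this.congr fun N => Finset.sum_congr rfl fun n _ => ?_
  rw [Matrix.smul_apply, smul_eq_mul, hg, Real.cos_arccos hx.1 hx.2]
  ring

variable [AddCommGroup T]

/-- Schoenberg's theorem is applied to scalar contractions of the matrix expansion, whose `n`-th
coefficient is `q n` times the quadratic form to be bounded. -/
lemma IsSeriesExpansion.isPosDefKernel_coeff (hd : 1 ≤ d) (hq : ∀ n, 0 < q n)
    (hg : ∀ n ϑ, g n ϑ = q n * (zonalPoly d n).eval (Real.cos ϑ))
    (hC : IsSeriesExpansion g B C) (hK : IsPosDefKernel (isotropicKernel d C)) (n : ℕ) :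
    IsPosDefKernel (stationaryKernel (B n)) := by
  refine ⟨fun p r => ?_, fun s w => ?_⟩
  -- Symmetry is uniqueness of coefficients: the two expansions have equal sums, and nonnegativity
  -- for the zero kernel is applied to their difference in both orders.
  · have hzero : IsPosDefKernel fun _ _ : UnitSphere d => (0 : ℝ) :=
      ⟨fun _ _ => rfl, fun _ _ => by simp⟩
    have hsymm : ∀ x ∈ Set.Icc (-1 : ℝ) 1,
        C (Real.arccos x) (p.1 - r.1) p.2 r.2 = C (Real.arccos x) (r.1 - p.1) r.2 p.2 := by
      intro x hx
      obtain ⟨y, hy⟩ := exists_inner_eq hd (northPole d) hx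
      have := hK.symm ((northPole d, p.1), p.2) ((y, r.1), r.2)
      simpa only [isotropicKernel, sphericalDist,
        real_inner_comm (northPole d : EuclideanSpace ℝ (Fin (d + 1))) y, hy] using this
    have h : ∀ p r : T × Fin m, (∀ x ∈ Set.Icc (-1 : ℝ) 1,
        C (Real.arccos x) (p.1 - r.1) p.2 r.2 = C (Real.arccos x) (r.1 - p.1) r.2 p.2) →
        B n (r.1 - p.1) r.2 p.2 ≤ B n (p.1 - r.1) p.2 r.2 := by
      intro p r hpr
      have h1 := coeff_nonneg_of_isPosDefKernel hd (f := fun _ => 0)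
        (b := fun n => q n * B n (p.1 - r.1) p.2 r.2 - q n * B n (r.1 - p.1) r.2 p.2)
        (fun x hx => by
          have := (hC.tendsto_entry hg hx (p.1 - r.1) p.2 r.2).sub
            (hC.tendsto_entry hg hx (r.1 - p.1) r.2 p.2)
          rw [hpr x hx, sub_self] at this
          refine this.congr fun N => ?_
          rw [← Finset.sum_sub_distrib]
          exact Finset.sum_congr rfl fun n _ => by ring) hzero n
      rw [← mul_sub] at h1
      exact sub_nonneg.1 (nonneg_of_mul_nonneg_right h1 (hq n))
    exact le_antisymm (h r p fun x hx => (hsymm x hx).symm) (h p r hsymm)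
  · obtain ⟨H, _, _, _, k, hk⟩ := hK.exists_feature
    -- The contracted kernel is the Gram kernel of the combined features `∑ w p • k ((x, p.1),
    -- p.2)`.
    have hker : IsPosDefKernel fun x y : UnitSphere d =>
        ∑ p ∈ s, ∑ r ∈ s, w p * w r * C (Real.arccos
          (inner ℝ (x : EuclideanSpace ℝ (Fin (d + 1))) y)) (p.1 - r.1) p.2 r.2 := by
      convert isPosDefKernel_inner fun x : UnitSphere d =>
        ∑ p ∈ s, w p • k ((x, p.1), p.2) using 3 with x y
      simp only [sum_inner, inner_sum, real_inner_smul_left, real_inner_smul_right, hk]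
      simp only [isotropicKernel, sphericalDist]
      rw [Finset.sum_comm]
      exact Finset.sum_congr rfl fun _ _ => Finset.sum_congr rfl fun _ _ => by ring
    have h1 := coeff_nonneg_of_isPosDefKernel hd
      (b := fun n => ∑ p ∈ s, ∑ r ∈ s, w p * w r * (q n * B n (p.1 - r.1) p.2 r.2))
      (f := fun c => ∑ p ∈ s, ∑ r ∈ s, w p * w r * C (Real.arccos c) (p.1 - r.1) p.2 r.2)
      (fun x hx => by
        have := tendsto_finsetSum s fun p _ => tendsto_finsetSum s fun r _ =>
          (hC.tendsto_entry hg hx (p.1 - r.1) p.2 r.2).const_mul (w p * w r)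
        refine this.congr fun N => ?_
        simp_rw [Finset.mul_sum, Finset.sum_mul]
        refine (Finset.sum_congr rfl fun p _ => Finset.sum_comm).trans ?_
        rw [Finset.sum_comm]
        exact Finset.sum_congr rfl fun n _ => Finset.sum_congr rfl fun p _ =>
          Finset.sum_congr rfl fun r _ => by ring) hker n
    refine nonneg_of_mul_nonneg_right (a := q n) ?_ (hq n)
    refine h1.trans_eq ?_
    simp_rw [Finset.mul_sum, stationaryKernel]
    exact Finset.sum_congr rfl fun p _ => Finset.sum_congr rfl fun r _ => by ring

/-- Ordinary convergence on the diagonal at time `0` is absolute, the terms being nonnegative;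
Cauchy–Schwarz bounds every other entry at every time by two diagonal ones. -/
lemma summable_mul_coeff_of_isPosDefKernel (hq : ∀ n, 0 < q n)
    (hB : ∀ n, IsPosDefKernel (stationaryKernel (B n)))
    {S : Matrix (Fin m) (Fin m) ℝ} (hS : SeriesTendsTo (fun n => q n • B n 0) S)
    {a : ℕ → ℝ} (ha : ∀ n, |a n| ≤ q n) (t : T) (i j : Fin m) :
    Summable fun n => a n * B n t i j := by
  have hdiag : ∀ i, Summable fun n => q n * B n 0 i i := fun i =>
    ((hasSum_iff_tendsto_nat_of_nonneg (fun n => mul_nonneg (hq n).le (by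
      simpa [stationaryKernel] using (hB n).self_nonneg (0, i))) _).2
      (seriesTendsTo_iff.1 hS i i)).summable
  refine Summable.of_norm_bounded (((hdiag i).add (hdiag j)).div_const 2) fun n => ?_
  have h := (hB n).abs_le (t, i) (0, j)
  simp only [stationaryKernel, sub_self, sub_zero] at h
  rw [norm_mul, ← mul_add, mul_div_assoc]
  exact mul_le_mul (ha n) h (norm_nonneg _) (hq n).le

lemma isPosDefKernel_isotropicKernel_zonalPoly (hd : 1 ≤ d) {A : T → Matrix (Fin m) (Fin m) ℝ}
    (hA : IsPosDefKernel (stationaryKernel A)) {c : ℝ} (hc : 0 ≤ c) (n : ℕ) :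
    IsPosDefKernel (isotropicKernel d fun ϑ t => (c * (zonalPoly d n).eval (Real.cos ϑ)) • A t) := by
  have hcos : ∀ x y : UnitSphere d, Real.cos (sphericalDist x y)
      = inner ℝ (x : EuclideanSpace ℝ (Fin (d + 1))) y := fun x y =>
    Real.cos_arccos (inner_mem_Icc x y).1 (inner_mem_Icc x y).2
  have hcomp := hA.comp fun p : (UnitSphere d × T) × Fin m => (p.1.2, p.2)
  refine ⟨fun p r => ?_, fun s w => ?_⟩
  · have := hcomp.symm p r
    simp only [stationaryKernel] at this
    simp only [isotropicKernel, Matrix.smul_apply, hcos, this]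
    rw [real_inner_comm]
  · have h := mul_nonneg hc (sum_mul_zonalPoly_nonneg hd (fun p => p.1.1) s (hcomp.nonneg s) n w)
    simp only [Finset.mul_sum] at h
    refine h.trans_eq (Finset.sum_congr rfl fun p _ => Finset.sum_congr rfl fun r _ => ?_)
    simp only [isotropicKernel, stationaryKernel, Matrix.smul_apply, hcos, smul_eq_mul]
    ring

theorem exists_expansion_iff (hd : 1 ≤ d) (hq : ∀ n, 0 < q n)
    (hg : ∀ n ϑ, g n ϑ = q n * (zonalPoly d n).eval (Real.cos ϑ)) :
    (∃ C : ℝ → T → Matrix (Fin m) (Fin m) ℝ,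
      IsSeriesExpansion g B C ∧ IsPosDefKernel (isotropicKernel d C)) ↔
    (∃ S, SeriesTendsTo (fun n => q n • B n 0) S) ∧
      ∀ n, IsPosDefKernel (stationaryKernel (B n)) := by
  constructor
  · rintro ⟨C, hC, hK⟩
    -- At `ϑ = 0`, `t = 0` every zonal factor equals `1`, which leaves the required series.
    refine ⟨⟨C 0 0, ?_⟩, hC.isPosDefKernel_coeff hd hq hg hK⟩
    have := hC 0 ⟨le_rfl, Real.pi_pos.le⟩ 0
    simpa only [hg, Real.cos_zero, zonalPoly_eval_one hd, mul_one] using this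
  · rintro ⟨⟨S, hS⟩, hB⟩
    have hgq : ∀ ϑ n, |g n ϑ| ≤ q n := by
      intro ϑ n
      rw [hg, abs_mul, abs_of_pos (hq n)]
      exact mul_le_of_le_one_right (hq n).le
        (abs_zonalPoly_eval_le_one hd n ⟨Real.neg_one_le_cos ϑ, Real.cos_le_one ϑ⟩)
    have hlim : ∀ ϑ t, SeriesTendsTo (fun n => g n ϑ • B n t)
        (Matrix.of fun i j => ∑' n, g n ϑ * B n t i j) := fun ϑ t =>
      seriesTendsTo_iff.2 fun i j =>
        (summable_mul_coeff_of_isPosDefKernel hq hB hS (hgq ϑ) t i j).hasSum.tendsto_sum_nat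
    refine ⟨fun ϑ t => Matrix.of fun i j => ∑' n, g n ϑ * B n t i j, fun ϑ _ t => hlim ϑ t, ?_⟩
    refine IsPosDefKernel.of_tendsto (K := fun N p r => ∑ n ∈ Finset.range N,
      isotropicKernel d (fun ϑ t => (q n * (zonalPoly d n).eval (Real.cos ϑ)) • B n t) p r)
      (fun N => IsPosDefKernel.sum
        (fun n => isPosDefKernel_isotropicKernel_zonalPoly hd (hB n) (hq n).le n) _)
      fun p r => ?_
    simp only [← hg]
    exact seriesTendsTo_iff.1 (hlim (sphericalDist p.1.1 r.1.1) (p.1.2 - r.1.2)) p.2 r.2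

end

/-! ### Cosines and ultraspherical polynomials as zonal polynomials; the theorem -/

lemma cos_nat_mul_eq_zonalPoly_eval (n : ℕ) (ϑ : ℝ) :
    Real.cos (n * ϑ) = (zonalPoly 1 n).eval (Real.cos ϑ) := by
  induction n using Nat.twoStepInduction with
  | zero => simp [zonalPoly]
  | one => simp [zonalPoly]
  | more n ih0 ih1 =>
    have h := congrArg (Polynomial.eval (Real.cos ϑ)) (zonalPoly_rec le_rfl n (d := 1))
    simp only [Polynomial.eval_mul, Polynomial.eval_sub, Polynomial.eval_C, Polynomial.eval_X,
      ← ih0, ← ih1] at h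
    have h2 : Real.cos ((n + 2 : ℕ) * ϑ)
        = 2 * Real.cos ϑ * Real.cos ((n + 1 : ℕ) * ϑ) - Real.cos (n * ϑ) := by
      have e1 : ((n + 2 : ℕ) : ℝ) * ϑ = (n + 1 : ℕ) * ϑ + ϑ := by push_cast; ring
      have e2 : (n : ℝ) * ϑ = (n + 1 : ℕ) * ϑ - ϑ := by push_cast; ring
      rw [e1, e2, Real.cos_add, Real.cos_sub]
      ring
    have h3 : (n : ℝ) + 1 ≠ 0 := by positivity
    apply mul_left_cancel₀ h3
    rw [h2]
    push_cast at h ⊢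
    linear_combination -h

/-- At `x = 1` the three-term recurrence collapses to a first-order one, which gives positivity and
the normalisation without a closed formula. -/
lemma ultraspherical_succ_one (lam : ℝ) (n : ℕ) :
    (n + 1) * ultraspherical lam (n + 1) 1 = (2 * lam + n) * ultraspherical lam n 1 := by
  induction n with
  | zero => simp [ultraspherical]
  | succ n ih =>
    have h : (n : ℝ) + 2 ≠ 0 := by positivity
    have h2 : ((n : ℝ) + 2) * ultraspherical lam (n + 2) 1
        = 2 * (lam + n + 1) * 1 * ultraspherical lam (n + 1) 1
          - (2 * lam + n) * ultraspherical lam n 1 := by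
      rw [ultraspherical]
      field_simp
    push_cast
    linear_combination h2 + ih

/-- Positivity fails at parameter `0`, which is the value for `d = 1`, where the polynomials with `n
≥ 1` vanish; the circle therefore uses cosines. -/
lemma ultraspherical_one_pos {lam : ℝ} (hlam : 0 < lam) (n : ℕ) : 0 < ultraspherical lam n 1 := by
  induction n with
  | zero => simp [ultraspherical]
  | succ n ih =>
    have h := ultraspherical_succ_one lam n
    have h1 : (0 : ℝ) < n + 1 := by positivity
    refine pos_of_mul_pos_right (a := (n : ℝ) + 1) ?_ h1.le
    rw [h]
    positivity

lemma ultraspherical_eq_mul_zonalPoly_eval {d : ℕ} (hd : 1 ≤ d) (n : ℕ) (x : ℝ) :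
    ultraspherical (((d : ℝ) - 1) / 2) n x
      = ultraspherical (((d : ℝ) - 1) / 2) n 1 * (zonalPoly d n).eval x := by
  induction n using Nat.twoStepInduction with
  | zero => simp [ultraspherical, zonalPoly]
  | one => simp [ultraspherical, zonalPoly]
  | more n ih0 ih1 =>
    have h := congrArg (Polynomial.eval x) (zonalPoly_rec hd n)
    simp only [Polynomial.eval_mul, Polynomial.eval_sub, Polynomial.eval_C, Polynomial.eval_X] at h
    have h1 := ultraspherical_succ_one (((d : ℝ) - 1) / 2) n
    have h2 := ultraspherical_succ_one (((d : ℝ) - 1) / 2) (n + 1)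
    have h3 : (n : ℝ) + 2 ≠ 0 := by positivity
    have h4 : ((n : ℝ) + 2) * ultraspherical (((d : ℝ) - 1) / 2) (n + 2) x
        = 2 * (((d : ℝ) - 1) / 2 + n + 1) * x * ultraspherical (((d : ℝ) - 1) / 2) (n + 1) x
          - (2 * (((d : ℝ) - 1) / 2) + n) * ultraspherical (((d : ℝ) - 1) / 2) n x := by
      rw [ultraspherical]
      field_simp
    apply mul_left_cancel₀ h3
    rw [h4, ih0, ih1]
    push_cast at h2
    generalize ultraspherical (((d : ℝ) - 1) / 2) (n + 2) 1 = u2 at *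
    generalize ultraspherical (((d : ℝ) - 1) / 2) (n + 1) 1 = u1 at *
    generalize ultraspherical (((d : ℝ) - 1) / 2) n 1 = u0 at *
    linear_combination (-u1) * h + (zonalPoly d n).eval x * h1 - (zonalPoly d (n + 2)).eval x * h2

theorem theorem2 (m : ℕ) (T : Type) [AddCommGroup T]
    (B : ℕ → T → Matrix (Fin m) (Fin m) ℝ) :
    -- (i) the circle
    (((∃ C : ℝ → T → Matrix (Fin m) (Fin m) ℝ,
          IsSeriesExpansion (fun n ϑ => Real.cos (n * ϑ)) B C ∧ IsCovFunOfGaussianField 1 C) ↔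
        ((∃ S, SeriesTendsTo (fun n => B n 0) S) ∧ ∀ n, IsStationaryCovFun (B n))) ∧
      ((∃ C : ℝ → T → Matrix (Fin m) (Fin m) ℝ,
          IsSeriesExpansion (fun n ϑ => Real.cos (n * ϑ)) B C ∧ IsCovFunOfEllipticalField 1 C) ↔
        ((∃ S, SeriesTendsTo (fun n => B n 0) S) ∧ ∀ n, IsStationaryCovFun (B n)))) ∧
    -- (ii) the spheres of dimension at least two
    (∀ d : ℕ, 2 ≤ d →
      ((∃ C : ℝ → T → Matrix (Fin m) (Fin m) ℝ,
          IsSeriesExpansion (fun n ϑ => ultraspherical (((d : ℝ) - 1) / 2) n (Real.cos ϑ)) B C ∧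
            IsCovFunOfGaussianField d C) ↔
        ((∃ S, SeriesTendsTo (fun n => ultraspherical (((d : ℝ) - 1) / 2) n 1 • B n 0) S) ∧
          ∀ n, IsStationaryCovFun (B n))) ∧
      ((∃ C : ℝ → T → Matrix (Fin m) (Fin m) ℝ,
          IsSeriesExpansion (fun n ϑ => ultraspherical (((d : ℝ) - 1) / 2) n (Real.cos ϑ)) B C ∧
            IsCovFunOfEllipticalField d C) ↔
        ((∃ S, SeriesTendsTo (fun n => ultraspherical (((d : ℝ) - 1) / 2) n 1 • B n 0) S) ∧
          ∀ n, IsStationaryCovFun (B n)))) := by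
  simp only [isCovFunOfGaussianField_iff, isCovFunOfEllipticalField_iff, isStationaryCovFun_iff,
    and_self]
  refine ⟨?_, fun d hd => ?_⟩
  · simpa only [one_smul] using exists_expansion_iff (d := 1) (q := fun _ => 1) le_rfl
      (fun _ => one_pos) fun n ϑ => by rw [one_mul, cos_nat_mul_eq_zonalPoly_eval]
  · have h : (2 : ℝ) ≤ d := by exact_mod_cast hd
    exact exists_expansion_iff (one_le_two.trans hd)
      (fun n => ultraspherical_one_pos (by linarith) n)
      fun n ϑ => ultraspherical_eq_mul_zonalPoly_eval (one_le_two.trans hd) n _
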